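/- Let $\Bbbk$ be a field of prime characteristic $p$ and let $n\ge 0$. Let $\mathrm{NH}_n$ be the nilHecke algebra: the $\Bbbk$-algebra with generators $x_1,\dots,x_n$, $\delta_1,\dots,\delta_{n-1}$ and relations $\delta_i^2=0$, $\delta_i\delta_{i+1}\delta_i=\delta_{i+1}\delta_i\delta_{i+1}$, $\delta_i\delta_j=\delta_j\delta_i$ for $|i-j|>1$, $x_ix_j=x_jx_i$, $x_i\delta_j=\delta_jx_i$ for $i\ne j,j+1$, and $x_i\delta_i-\delta_ix_{i+1}=1=\delta_ix_i-x_{i+1}\delta_i$, graded by $\deg x_i=2$, $\deg\delta_i=-2$. For $a\in\Bbbk$ let $\partial_a$ be the derivation of $\mathrm{NH}_n$ with $\partial_a(x_i)=x_i^2$ and $\partial_a(\delta_i)=a-(a+1)x_i\delta_i+(a-1)x_{i+1}\delta_i$. Let $\mathrm{NH}_n$ act on $\mathrm{Pol}_n=\Bbbk[x_1,\dots,x_n]$, with $x_i$ acting by multiplication and $\delta_i$ by $f\mapsto (f-s_if)/(x_i-x_{i+1})$. Let $\mathrm{Sym}_n'$ be the set of symmetric polynomials with zero constant term; then $\mathrm{Sym}_n'\cdot\mathrm{NH}_n$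 is a $\partial_a$-stable two-sided ideal. Put $\overline U_n=\mathrm{Pol}_n/\mathrm{Pol}_n\cdot\mathrm{Sym}_n'$, and let $U_n^+\subset\mathrm{Pol}_n$ be the span of the monomials $x_1^{b_1}\cdots x_n^{b_n}$ with $0\le b_t\le n-t$, which the quotient map identifies with $\overline U_n$. A $p$-DG algebra is a $\mathbb Z$-graded $\Bbbk$-algebra with a derivation $\partial$ of degree $2$ such that $\partial^p=0$. Two morphisms $f,g:U\to W$ of $p$-complexes (degree $0$ linear maps commuting with $\partial$) are homotopic if $f-g=\sum_{j=0}^{p-1}\partial^{p-1-j}h\,\partial^{j}$ for some linear map $h:U\to W$ of degree $2-2p$; a quasi-isomorphism is a morphism that is invertible up to homotopy of $p$-complexes, and such an inverse is called a quasi-inverse. (1) For $a=\pm1$, $(\mathrm{NH}_n,\partial_a)$ and its quotient $\mathrm{NH}_n/(\mathrm{Sym}_n'\cdot\mathrm{NH}_n)$ with the induced grading and differential are $p$-DG algebras, and the canonical surjection $$\pi_n:\mathrm{NH}_n\to\mathrm{NH}_n/(\mathrm{Sym}_n'\cdot\mathrm{NH}_n)$$ is a homomorphism of $p$-DG algebras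 and a quasi-isomorphism. The action on $\overline U_n$ identifies the quotient with $\mathrm{END}_{\Bbbk}(\overline U_n)$, where $\dim\overline U_n=n!$, so the quotient is isomorphic to the matrix algebra $\mathrm M(n!,\Bbbk)$. (2) There is a unique algebra homomorphism $\jmath_n:\mathrm{NH}_n/(\mathrm{Sym}_n'\cdot\mathrm{NH}_n)\to\mathrm{NH}_n$ such that each $\jmath_n(m)$ preserves $U_n^+$ and acts on $U_n^+\cong\overline U_n$ as $m$ does. For the differentials $\partial_1$, $\jmath_n$ is an injective homomorphism of $p$-DG algebras with $\pi_n\circ\jmath_n=\mathrm{Id}$, and it is a quasi-inverse of $\pi_n$. -/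

import Mathlib

noncomputable section

namespace PDG

open MvPolynomial

/-! ### `p`-complexes and `p`-DG algebras

A graded vector space is a vector space `U` with a family `𝒰 : ℤ → Submodule k U`; a differential
is a `k`-linear endomorphism. -/

section
variable {k U W : Type*} [Field k] [AddCommGroup U] [Module k U] [AddCommGroup W] [Module k W]

/-- `f` is a morphism of `p`-complexes: it has degree `0` and commutes with the differentials. -/
def IsMorphism (𝒰 : ℤ → Submodule k U) (𝒲 : ℤ → Submodule k W) (dU : Module.End k U)
    (dW : Module.End k W) (f : U →ₗ[k] W) : Prop :=
  (∀ i, ∀ u ∈ 𝒰 i, f u ∈ 𝒲 i) ∧ f ∘ₗ dU = dW ∘ₗ f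

/-- `f` and `g` are homotopic: there is a `k`-linear map `h` of degree `2 - 2p` with
`f - g = ∑_{j=0}^{p-1} ∂^{p-1-j} ∘ h ∘ ∂^j`. Equivalently, `f` and `g` are equal in the stable
category of graded `k[∂]/(∂^p)`-modules. -/
def Homotopic (p : ℕ) (𝒰 : ℤ → Submodule k U) (𝒲 : ℤ → Submodule k W) (dU : Module.End k U)
    (dW : Module.End k W) (f g : U →ₗ[k] W) : Prop :=
  ∃ h : U →ₗ[k] W, (∀ i, ∀ u ∈ 𝒰 i, h u ∈ 𝒲 (i + (2 - 2 * (p : ℤ)))) ∧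
    f - g = ∑ j ∈ Finset.range p, (dW ^ (p - 1 - j)) ∘ₗ h ∘ₗ (dU ^ j)

/-- `f : U → W` and `g : W → U` are morphisms of `p`-complexes that are mutually inverse up to
homotopy. -/
def AreQuasiInverse (p : ℕ) (𝒰 : ℤ → Submodule k U) (𝒲 : ℤ → Submodule k W) (dU : Module.End k U)
    (dW : Module.End k W) (f : U →ₗ[k] W) (g : W →ₗ[k] U) : Prop :=
  IsMorphism 𝒰 𝒲 dU dW f ∧ IsMorphism 𝒲 𝒰 dW dU g ∧
    Homotopic p 𝒰 𝒰 dU dU (g ∘ₗ f) LinearMap.id ∧ Homotopic p 𝒲 𝒲 dW dW (f ∘ₗ g) LinearMap.id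

/-- `f` is a quasi-isomorphism: an isomorphism of `p`-complexes up to homotopy. -/
def IsQuasiIso (p : ℕ) (𝒰 : ℤ → Submodule k U) (𝒲 : ℤ → Submodule k W) (dU : Module.End k U)
    (dW : Module.End k W) (f : U →ₗ[k] W) : Prop :=
  ∃ g : W →ₗ[k] U, AreQuasiInverse p 𝒰 𝒲 dU dW f g

end

section
variable {k A B : Type*} [Field k] [Ring A] [Algebra k A] [Ring B] [Algebra k B]

/-- `A` with the grading `𝒜` and the differential `d` is a `p`-DG algebra. -/
structure IsPDGAlgebra (p : ℕ) (𝒜 : ℤ → Submodule k A) (d : Module.End k A) : Prop where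
  gradedMonoid : SetLike.GradedMonoid 𝒜
  isInternal : DirectSum.IsInternal 𝒜
  degree_two : ∀ i, ∀ a ∈ 𝒜 i, d a ∈ 𝒜 (i + 2)
  nilpotent : d ^ p = 0
  leibniz : ∀ a b, d (a * b) = d a * b + a * d b

/-- `f` is a homomorphism of `p`-DG algebras: an algebra homomorphism of degree `0` that commutes
with the differentials. -/
def IsPDGHom (𝒜 : ℤ → Submodule k A) (ℬ : ℤ → Submodule k B) (dA : Module.End k A)
    (dB : Module.End k B) (f : A →ₐ[k] B) : Prop :=
  (∀ i, ∀ a ∈ 𝒜 i, f a ∈ ℬ i) ∧ ∀ a, f (dA a) = dB (f a)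

end

/-! ### The nilHecke algebra -/

/-- The generators: a dot on strand `i`, and the crossing of strands `i` and `i + 1`
(strands are numbered from `0`). -/
inductive Gen (n : ℕ) : Type
  | dot (i : Fin n) : Gen n
  | cross (i : ℕ) (hi : i + 1 < n) : Gen n

/-- The nilHecke relations for elements `x i`, `δ i` of a ring. -/
structure NilHeckeRelations {A : Type*} [Ring A] {n : ℕ}
    (x : Fin n → A) (δ : ∀ i : ℕ, i + 1 < n → A) : Prop where
  sq : ∀ i hi, δ i hi * δ i hi = 0
  braid : ∀ (i : ℕ) (hi : i + 1 + 1 < n),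
    δ i (Nat.lt_of_succ_lt hi) * δ (i + 1) hi * δ i (Nat.lt_of_succ_lt hi)
      = δ (i + 1) hi * δ i (Nat.lt_of_succ_lt hi) * δ (i + 1) hi
  far : ∀ i hi j hj, (i + 1 < j ∨ j + 1 < i) → δ i hi * δ j hj = δ j hj * δ i hi
  dot_cross : ∀ (i : Fin n) j hj, (i : ℕ) ≠ j → (i : ℕ) ≠ j + 1 → x i * δ j hj = δ j hj * x i
  dot_dot : ∀ i j, x i * x j = x j * x i
  slide_left : ∀ i hi, x ⟨i, Nat.lt_of_succ_lt hi⟩ * δ i hi - δ i hi * x ⟨i + 1, hi⟩ = 1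
  slide_right : ∀ i hi, δ i hi * x ⟨i, Nat.lt_of_succ_lt hi⟩ - x ⟨i + 1, hi⟩ * δ i hi = 1

variable (k : Type*) [Field k] (n : ℕ)

/-- The defining relations of the nilHecke algebra, as a relation on the free algebra. -/
inductive Rel : FreeAlgebra k (Gen n) → FreeAlgebra k (Gen n) → Prop
  | sq (i : ℕ) (hi : i + 1 < n) :
      Rel (FreeAlgebra.ι k (.cross i hi) * FreeAlgebra.ι k (.cross i hi)) 0
  | braid (i : ℕ) (hi : i + 1 + 1 < n) :
      Rel (FreeAlgebra.ι k (.cross i (Nat.lt_of_succ_lt hi)) * FreeAlgebra.ι k (.cross (i + 1) hi)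
            * FreeAlgebra.ι k (.cross i (Nat.lt_of_succ_lt hi)))
          (FreeAlgebra.ι k (.cross (i + 1) hi) * FreeAlgebra.ι k (.cross i (Nat.lt_of_succ_lt hi))
            * FreeAlgebra.ι k (.cross (i + 1) hi))
  | far (i : ℕ) (hi : i + 1 < n) (j : ℕ) (hj : j + 1 < n) (h : i + 1 < j ∨ j + 1 < i) :
      Rel (FreeAlgebra.ι k (.cross i hi) * FreeAlgebra.ι k (.cross j hj))
          (FreeAlgebra.ι k (.cross j hj) * FreeAlgebra.ι k (.cross i hi))
  | dot_cross (i : Fin n) (j : ℕ) (hj : j + 1 < n) (h : (i : ℕ) ≠ j) (h' : (i : ℕ) ≠ j + 1) :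
      Rel (FreeAlgebra.ι k (.dot i) * FreeAlgebra.ι k (.cross j hj))
          (FreeAlgebra.ι k (.cross j hj) * FreeAlgebra.ι k (.dot i))
  | dot_dot (i j : Fin n) :
      Rel (FreeAlgebra.ι k (.dot i) * FreeAlgebra.ι k (.dot j))
          (FreeAlgebra.ι k (.dot j) * FreeAlgebra.ι k (.dot i))
  | slide_left (i : ℕ) (hi : i + 1 < n) :
      Rel (FreeAlgebra.ι k (.dot ⟨i, Nat.lt_of_succ_lt hi⟩) * FreeAlgebra.ι k (.cross i hi)
            - FreeAlgebra.ι k (.cross i hi) * FreeAlgebra.ι k (.dot ⟨i + 1, hi⟩)) 1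
  | slide_right (i : ℕ) (hi : i + 1 < n) :
      Rel (FreeAlgebra.ι k (.cross i hi) * FreeAlgebra.ι k (.dot ⟨i, Nat.lt_of_succ_lt hi⟩)
            - FreeAlgebra.ι k (.dot ⟨i + 1, hi⟩) * FreeAlgebra.ι k (.cross i hi)) 1

/-- The nilHecke algebra `NH_n` over `k`, by generators and relations. -/
abbrev NH : Type _ := RingQuot (Rel k n)

variable {k n}

/-- A generator as an element of `NH_n`. -/
def gen (g : Gen n) : NH k n := RingQuot.mkAlgHom k (Rel k n) (FreeAlgebra.ι k g)

variable (k) in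
/-- The dot `x_i`. -/
def x (i : Fin n) : NH k n := gen (.dot i)

variable (k) in
/-- The crossing `δ_i`. -/
def δ (i : ℕ) (hi : i + 1 < n) : NH k n := gen (.cross i hi)

theorem nilHeckeRelations : NilHeckeRelations (x (n := n) k) (δ k) where
  sq i hi := by simpa [δ, gen] using RingQuot.mkAlgHom_rel k (Rel.sq (k := k) i hi)
  braid i hi := by simpa [δ, gen] using RingQuot.mkAlgHom_rel k (Rel.braid (k := k) i hi)
  far i hi j hj h := by simpa [δ, gen] using RingQuot.mkAlgHom_rel k (Rel.far (k := k) i hi j hj h)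
  dot_cross i j hj h h' := by
    simpa [x, δ, gen] using RingQuot.mkAlgHom_rel k (Rel.dot_cross (k := k) i j hj h h')
  dot_dot i j := by simpa [x, gen] using RingQuot.mkAlgHom_rel k (Rel.dot_dot (k := k) i j)
  slide_left i hi := by
    have := RingQuot.mkAlgHom_rel k (Rel.slide_left (k := k) i hi)
    simpa [x, δ, gen] using this
  slide_right i hi := by
    have := RingQuot.mkAlgHom_rel k (Rel.slide_right (k := k) i hi)
    simpa [x, δ, gen] using this

/-- The values on generators given by the values on dots and on crossings. -/
def Gen.elim {A : Type*} (X : Fin n → A) (D : ∀ i : ℕ, i + 1 < n → A) : Gen n → A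
  | .dot i => X i
  | .cross i hi => D i hi

/-- The universal property of `NH_n`. -/
def lift {A : Type*} [Ring A] [Algebra k A] (X : Fin n → A) (D : ∀ i : ℕ, i + 1 < n → A)
    (h : NilHeckeRelations X D) : NH k n →ₐ[k] A :=
  RingQuot.liftAlgHom k ⟨FreeAlgebra.lift k (Gen.elim X D), by
    intro a b r
    cases r with
    | sq i hi => simpa [Gen.elim] using h.sq i hi
    | braid i hi => simpa [Gen.elim] using h.braid i hi
    | far i hi j hj hij => simpa [Gen.elim] using h.far i hi j hj hij
    | dot_cross i j hj h1 h2 => simpa [Gen.elim] using h.dot_cross i j hj h1 h2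
    | dot_dot i j => simp [Gen.elim, h.dot_dot i j]
    | slide_left i hi => simpa [Gen.elim] using h.slide_left i hi
    | slide_right i hi => simpa [Gen.elim] using h.slide_right i hi⟩

section
variable {A : Type*} [Ring A] [Algebra k A] {X : Fin n → A} {D : ∀ i : ℕ, i + 1 < n → A}

@[simp] theorem lift_x (h : NilHeckeRelations X D) (i : Fin n) : lift (k := k) X D h (x k i) = X i := by
  simp [lift, x, gen, Gen.elim]

@[simp] theorem lift_δ (h : NilHeckeRelations X D) (i : ℕ) (hi : i + 1 < n) :
    lift (k := k) X D h (δ k i hi) = D i hi := by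
  simp [lift, δ, gen, Gen.elim]

theorem algHom_ext {f g : NH k n →ₐ[k] A} (hx : ∀ i, f (x k i) = g (x k i))
    (hδ : ∀ i hi, f (δ k i hi) = g (δ k i hi)) : f = g := by
  apply RingQuot.ringQuot_ext'
  ext a
  cases a with
  | dot i => exact hx i
  | cross i hi => exact hδ i hi
end

theorem adjoin_gen : Algebra.adjoin k (Set.range (gen (k := k) (n := n))) = ⊤ := by
  rw [eq_top_iff]
  rintro y -
  obtain ⟨y, rfl⟩ := RingQuot.mkAlgHom_surjective k (Rel k n) y
  induction y using FreeAlgebra.induction with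
  | grade0 r => simp
  | grade1 g => exact Algebra.subset_adjoin ⟨g, rfl⟩
  | mul a b ha hb => simpa using mul_mem ha hb
  | add a b ha hb => simpa using add_mem ha hb

/-! ### The differential -/

section
variable {A : Type*} [Ring A] [Algebra k A]

theorem d_sq_aux (a : k) {u v s : A} (ss : s * s = 0) (hl : u * s - s * v = 1)
    (hr : s * u - v * s = 1) :
    s * (a • 1 - (a + 1) • (u * s) + (a - 1) • (v * s))
      + (a • 1 - (a + 1) • (u * s) + (a - 1) • (v * s)) * s = 0 := by
  have e1 : s * u = v * s + 1 := sub_eq_iff_eq_add'.1 hr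
  have e2 : s * v = u * s - 1 := by rw [← hl]; abel
  have h1 : s * (u * s) = s := by rw [← mul_assoc, e1, add_mul, mul_assoc, ss]; simp
  have h2 : s * (v * s) = - s := by rw [← mul_assoc, e2, sub_mul, mul_assoc, ss]; simp
  simp only [mul_add, mul_sub, add_mul, sub_mul, mul_smul_comm, smul_mul_assoc, mul_assoc, ss,
    h1, h2, mul_one, one_mul, mul_zero]
  module

theorem d_braid_aux (a : k) {u v w s t : A} (ss : s * s = 0) (tt : t * t = 0)
    (sts : s * t * s = t * s * t) (hl : u * s - s * v = 1) (hr : s * u - v * s = 1)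
    (hl' : v * t - t * w = 1) (hr' : t * v - w * t = 1) (sw : w * s = s * w) (tu : u * t = t * u) :
    s * t * (a • 1 - (a + 1) • (u * s) + (a - 1) • (v * s))
      + (s * (a • 1 - (a + 1) • (v * t) + (a - 1) • (w * t))
      + (a • 1 - (a + 1) • (u * s) + (a - 1) • (v * s)) * t) * s
    = t * s * (a • 1 - (a + 1) • (v * t) + (a - 1) • (w * t))
      + (t * (a • 1 - (a + 1) • (u * s) + (a - 1) • (v * s))
      + (a • 1 - (a + 1) • (v * t) + (a - 1) • (w * t)) * s) * t := by
  have e1 : s * u = v * s + 1 := sub_eq_iff_eq_add'.1 hr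
  have e2 : s * v = u * s - 1 := by rw [← hl]; abel
  have e3 : t * v = w * t + 1 := sub_eq_iff_eq_add'.1 hr'
  have e4 : t * w = v * t - 1 := by rw [← hl']; abel
  have f1 : ∀ z, s * (u * z) = v * (s * z) + z := fun z => by
    rw [← mul_assoc, e1, add_mul, one_mul, mul_assoc]
  have f2 : ∀ z, s * (v * z) = u * (s * z) - z := fun z => by
    rw [← mul_assoc, e2, sub_mul, one_mul, mul_assoc]
  have f3 : ∀ z, t * (v * z) = w * (t * z) + z := fun z => by
    rw [← mul_assoc, e3, add_mul, one_mul, mul_assoc]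
  have f4 : ∀ z, t * (w * z) = v * (t * z) - z := fun z => by
    rw [← mul_assoc, e4, sub_mul, one_mul, mul_assoc]
  have f5 : ∀ z, s * (w * z) = w * (s * z) := fun z => by rw [← mul_assoc, ← sw, mul_assoc]
  have f6 : ∀ z, t * (u * z) = u * (t * z) := fun z => by rw [← mul_assoc, ← tu, mul_assoc]
  have sts' : s * (t * s) = t * (s * t) := by rw [← mul_assoc, sts, mul_assoc]
  simp only [mul_add, mul_sub, add_mul, sub_mul, mul_smul_comm, smul_mul_assoc, mul_assoc, ss, tt,
    sts', f1, f2, f3, f4, f5, f6, mul_one, one_mul, smul_add, smul_sub]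
  module

theorem d_slide_aux (a : k) {u v s : A} (hl : u * s - s * v = 1) (hr : s * u - v * s = 1)
    (uv : u * v = v * u) :
    (u * (a • 1 - (a + 1) • (u * s) + (a - 1) • (v * s)) + u ^ 2 * s)
      - (s * v ^ 2 + (a • 1 - (a + 1) • (u * s) + (a - 1) • (v * s)) * v) = 0 ∧
    (s * u ^ 2 + (a • 1 - (a + 1) • (u * s) + (a - 1) • (v * s)) * u)
      - (v * (a • 1 - (a + 1) • (u * s) + (a - 1) • (v * s)) + v ^ 2 * s) = 0 := by
  have e1 : s * u = v * s + 1 := sub_eq_iff_eq_add'.1 hr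
  have e2 : s * v = u * s - 1 := by rw [← hl]; abel
  have f1 : ∀ z, s * (u * z) = v * (s * z) + z := fun z => by
    rw [← mul_assoc, e1, add_mul, one_mul, mul_assoc]
  have f2 : ∀ z, s * (v * z) = u * (s * z) - z := fun z => by
    rw [← mul_assoc, e2, sub_mul, one_mul, mul_assoc]
  have f3 : ∀ z, u * (v * z) = v * (u * z) := fun z => by rw [← mul_assoc, uv, mul_assoc]
  constructor <;>
  · simp only [pow_two, mul_add, mul_sub, add_mul, sub_mul, mul_smul_comm, smul_mul_assoc,
      mul_assoc, e1, e2, f1, f2, f3, mul_one, one_mul, smul_add, smul_sub]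
    module
end

/-- The value `a - (a + 1) x_i δ_i + (a - 1) x_{i+1} δ_i` of the differential on a crossing. -/
def dδ (a : k) (i : ℕ) (hi : i + 1 < n) : NH k n :=
  a • 1 - (a + 1) • (x k ⟨i, Nat.lt_of_succ_lt hi⟩ * δ k i hi)
    + (a - 1) • (x k ⟨i + 1, hi⟩ * δ k i hi)

theorem dRelations (a : k) : NilHeckeRelations
    (A := TrivSqZeroExt (NH k n) (NH k n))
    (fun i => .inl (x k i) + .inr (x k i ^ 2))
    (fun i hi => .inl (δ k i hi) + .inr (dδ a i hi)) := by
  have R := nilHeckeRelations (k := k) (n := n)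
  have xδ : ∀ (i : Fin n) j hj, (i : ℕ) ≠ j → (i : ℕ) ≠ j + 1 → Commute (x k i) (δ k j hj) :=
    R.dot_cross
  have xx : ∀ (i j : Fin n), Commute (x k i) (x k j) := R.dot_dot
  have δδ : ∀ i hi j hj, (i + 1 < j ∨ j + 1 < i) → Commute (δ k i hi) (δ k j hj) := R.far
  have dx : ∀ (z : NH k n) (j : ℕ) (hj : j + 1 < n), Commute z (δ k j hj) →
      Commute z (x k ⟨j, Nat.lt_of_succ_lt hj⟩) → Commute z (x k ⟨j + 1, hj⟩) →
      Commute z (dδ a j hj) := fun z j hj h0 h1 h2 =>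
    (((Commute.one_right z).smul_right a).sub_right ((h1.mul_right h0).smul_right _)).add_right
      ((h2.mul_right h0).smul_right _)
  constructor
  · intro i hi
    apply TrivSqZeroExt.ext
    · simp [R.sq]
    · simpa using show δ k i hi * dδ a i hi + dδ a i hi * δ k i hi = 0 from
        d_sq_aux a (R.sq i hi) (R.slide_left i hi) (R.slide_right i hi)
  · intro i hi
    apply TrivSqZeroExt.ext
    · simp [R.braid]
    · have h := Nat.lt_of_succ_lt hi
      simpa [add_mul, add_assoc] using show δ k i h * δ k (i + 1) hi * dδ a i h
          + (δ k i h * dδ a (i + 1) hi + dδ a i h * δ k (i + 1) hi) * δ k i h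
        = δ k (i + 1) hi * δ k i h * dδ a (i + 1) hi
          + (δ k (i + 1) hi * dδ a i h + dδ a (i + 1) hi * δ k i h) * δ k (i + 1) hi from
        d_braid_aux a (R.sq i h) (R.sq (i + 1) hi) (R.braid i hi)
        (R.slide_left i h) (R.slide_right i h) (R.slide_left (i + 1) hi) (R.slide_right (i + 1) hi)
        (R.dot_cross ⟨i + 1 + 1, hi⟩ i h (by simp; omega) (by simp))
        (R.dot_cross ⟨i, by omega⟩ (i + 1) hi (by simp) (by simp; omega))
  · intro i hi j hj h
    have c1 : Commute (δ k i hi) (dδ a j hj) := dx _ _ _ (δδ i hi j hj h)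
      (xδ _ _ _ (by simp; omega) (by simp; omega)).symm
      (xδ _ _ _ (by simp; omega) (by simp; omega)).symm
    have c2 : Commute (δ k j hj) (dδ a i hi) := dx _ _ _ (δδ j hj i hi h.symm)
      (xδ _ _ _ (by simp; omega) (by simp; omega)).symm
      (xδ _ _ _ (by simp; omega) (by simp; omega)).symm
    apply TrivSqZeroExt.ext
    · simpa using R.far i hi j hj h
    · simp [c1.eq, c2.eq, add_comm]
  · intro i j hj h h'
    have c1 : Commute (x k i) (dδ a j hj) := dx _ _ _ (xδ _ _ _ h h') (xx _ _) (xx _ _)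
    have c2 : Commute (x k i ^ 2) (δ k j hj) := (xδ _ _ _ h h').pow_left 2
    apply TrivSqZeroExt.ext
    · simpa using R.dot_cross i j hj h h'
    · simp [c1.eq, c2.eq, add_comm]
  · intro i j
    have c1 : Commute (x k i) (x k j ^ 2) := (xx i j).pow_right 2
    have c2 : Commute (x k i ^ 2) (x k j) := (xx i j).pow_left 2
    apply TrivSqZeroExt.ext
    · simpa using R.dot_dot i j
    · simp [c1.eq, c2.eq, add_comm]
  · intro i hi
    apply TrivSqZeroExt.ext
    · simpa using R.slide_left i hi
    · simpa using show (x k ⟨i, Nat.lt_of_succ_lt hi⟩ * dδ a i hi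
          + x k ⟨i, Nat.lt_of_succ_lt hi⟩ ^ 2 * δ k i hi)
        - (δ k i hi * x k ⟨i + 1, hi⟩ ^ 2 + dδ a i hi * x k ⟨i + 1, hi⟩) = 0 from
        (d_slide_aux a (R.slide_left i hi) (R.slide_right i hi) (xx _ _)).1
  · intro i hi
    apply TrivSqZeroExt.ext
    · simpa using R.slide_right i hi
    · simpa using show (δ k i hi * x k ⟨i, Nat.lt_of_succ_lt hi⟩ ^ 2
          + dδ a i hi * x k ⟨i, Nat.lt_of_succ_lt hi⟩)
        - (x k ⟨i + 1, hi⟩ * dδ a i hi + x k ⟨i + 1, hi⟩ ^ 2 * δ k i hi) = 0 from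
        (d_slide_aux a (R.slide_left i hi) (R.slide_right i hi) (xx _ _)).2

/-- The algebra homomorphism `y ↦ y + ∂_a(y) ε` to the dual numbers over `NH_n`. -/
def dHom (a : k) : NH k n →ₐ[k] TrivSqZeroExt (NH k n) (NH k n) := lift _ _ (dRelations a)

theorem fst_dHom (a : k) (y : NH k n) : (dHom a y).fst = y := by
  have : (TrivSqZeroExt.fstHom k (NH k n) (NH k n)).comp (dHom a) = AlgHom.id k _ :=
    algHom_ext (by simp [dHom]) (by simp [dHom])
  exact DFunLike.congr_fun this y

/-- The differential `∂_a` of `NH_n`: the derivation with `∂_a(x_i) = x_i ^ 2` and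
`∂_a(δ_i) = a - (a + 1) x_i δ_i + (a - 1) x_{i+1} δ_i`. -/
def d (a : k) : NH k n →ₗ[k] NH k n where
  toFun y := (dHom a y).snd
  map_add' y z := by simp
  map_smul' c y := by simp

@[simp] theorem d_x (a : k) (i : Fin n) : d a (x k i) = x k i ^ 2 := by simp [d, dHom]

@[simp] theorem d_δ (a : k) (i : ℕ) (hi : i + 1 < n) :
    d a (δ k i hi) = a • 1 - (a + 1) • (x k ⟨i, Nat.lt_of_succ_lt hi⟩ * δ k i hi)
      + (a - 1) • (x k ⟨i + 1, hi⟩ * δ k i hi) := by simp [d, dHom, dδ]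

theorem d_mul (a : k) (y z : NH k n) : d a (y * z) = d a y * z + y * d a z := by
  simp [d, fst_dHom, add_comm]

/-! ### Polynomials and divided differences -/

variable (k n) in
/-- `Pol_n = k[x_1, …, x_n]`. -/
abbrev Pol : Type _ := MvPolynomial (Fin n) k

/-- The action on `Pol_n` of the transposition of the variables `x_i` and `x_j`. -/
abbrev sw (i j : Fin n) : Pol k n →ₐ[k] Pol k n := MvPolynomial.rename (Equiv.swap i j)

theorem sw_sw (i j : Fin n) (f : Pol k n) : sw i j (sw i j f) = f := by
  have : (Equiv.swap i j : Fin n → Fin n) ∘ Equiv.swap i j = id := by ext; simp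
  simp [sw, MvPolynomial.rename_rename, this]

theorem X_sub_X_ne {i j : Fin n} (h : i ≠ j) : (X i - X j : Pol k n) ≠ 0 :=
  sub_ne_zero.2 fun e => h (MvPolynomial.X_injective e)

theorem dvd_sub_sw (i j : Fin n) (f : Pol k n) : (X i - X j : Pol k n) ∣ f - sw i j f := by
  rw [← Ideal.mem_span_singleton, ← Ideal.Quotient.mk_eq_mk_iff_sub_mem]
  set I := Ideal.span {(X i - X j : Pol k n)}
  have hX : Ideal.Quotient.mk I (X i) = Ideal.Quotient.mk I (X j) :=
    (Ideal.Quotient.mk_eq_mk_iff_sub_mem _ _).2 (Ideal.mem_span_singleton_self _)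
  have : Ideal.Quotient.mkₐ k I = (Ideal.Quotient.mkₐ k I).comp (sw i j) := by
    apply MvPolynomial.algHom_ext
    intro l
    rcases eq_or_ne l i with rfl | hi
    · simp [hX]
    rcases eq_or_ne l j with rfl | hj
    · simp [hX]
    · simp [Equiv.swap_apply_of_ne_of_ne hi hj]
  exact DFunLike.congr_fun this f

/-- The divided difference `f ↦ (f - s_{ij} f) / (x_i - x_j)`, for `i ≠ j`. -/
def dd (i j : Fin n) (h : i ≠ j) : Pol k n →ₗ[k] Pol k n where
  toFun f := (dvd_sub_sw i j f).choose
  map_add' f g := by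
    apply mul_left_cancel₀ (X_sub_X_ne h)
    rw [mul_add, ← (dvd_sub_sw i j _).choose_spec, ← (dvd_sub_sw i j _).choose_spec,
      ← (dvd_sub_sw i j _).choose_spec, map_add]
    ring
  map_smul' c f := by
    apply mul_left_cancel₀ (X_sub_X_ne h)
    rw [RingHom.id_apply, mul_smul_comm, ← (dvd_sub_sw i j _).choose_spec,
      ← (dvd_sub_sw i j _).choose_spec, map_smul, smul_sub]

theorem mul_dd (i j : Fin n) (h : i ≠ j) (f : Pol k n) :
    (X i - X j) * dd i j h f = f - sw i j f :=
  (dvd_sub_sw i j f).choose_spec.symm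

theorem sw_dd (i j : Fin n) (h : i ≠ j) (f : Pol k n) : sw i j (dd i j h f) = dd i j h f := by
  apply mul_left_cancel₀ (X_sub_X_ne h)
  have := congrArg (sw i j) (mul_dd i j h f)
  rw [map_mul, map_sub, map_sub, sw_sw] at this
  simp only [MvPolynomial.rename_X, Equiv.swap_apply_left, Equiv.swap_apply_right] at this
  rw [mul_dd]
  linear_combination -this

theorem dd_mul (i j : Fin n) (h : i ≠ j) (f g : Pol k n) :
    dd i j h (f * g) = dd i j h f * g + sw i j f * dd i j h g := by
  apply mul_left_cancel₀ (X_sub_X_ne h)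
  rw [mul_dd, map_mul]
  linear_combination (-g) * mul_dd i j h f - sw i j f * mul_dd i j h g

theorem dd_of_sw_eq (i j : Fin n) (h : i ≠ j) (f : Pol k n) (hf : sw i j f = f) :
    dd i j h f = 0 := by
  apply mul_left_cancel₀ (X_sub_X_ne h)
  rw [mul_dd, hf, sub_self, mul_zero]

theorem dd_X_left (i j : Fin n) (h : i ≠ j) : dd i j h (X i : Pol k n) = 1 := by
  apply mul_left_cancel₀ (X_sub_X_ne h)
  rw [mul_dd]; simp

theorem dd_X_right (i j : Fin n) (h : i ≠ j) : dd i j h (X j : Pol k n) = -1 := by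
  apply mul_left_cancel₀ (X_sub_X_ne h)
  rw [mul_dd]; simp

theorem mul_dd_braid (i j l : Fin n) (hij : i ≠ j) (hjl : j ≠ l) (hil : i ≠ l) (f : Pol k n) :
    (X i - X j) * (X j - X l) * (X i - X l) * dd i j hij (dd j l hjl (dd i j hij f))
      = f - sw i j f - sw j l f + sw i j (sw j l f) + sw j l (sw i j f)
        - sw i j (sw j l (sw i j f)) := by
  set g := dd i j hij f with hg
  set e := dd j l hjl g with he
  have h1 := mul_dd i j hij f
  have h2 := mul_dd j l hjl g
  have h3 := mul_dd i j hij e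
  have hs : sw i j g = g := sw_dd i j hij f
  have a2 := congrArg (sw i j) h2
  have a1 := congrArg (sw j l) h1
  have a3 := congrArg (sw i j) a1
  rw [← hg] at h1 a1 a3
  rw [← he] at h2 a2
  have w1 : Equiv.swap i j l = l := Equiv.swap_apply_of_ne_of_ne hil.symm hjl.symm
  have w2 : Equiv.swap j l i = i := Equiv.swap_apply_of_ne_of_ne hij hil
  simp only [map_sub, map_mul, MvPolynomial.rename_X, Equiv.swap_apply_left,
    Equiv.swap_apply_right, w1, w2, hs] at a1 a2 a3
  linear_combination (X j - X l) * (X i - X l) * h3 + (X i - X l) * h2 - (X j - X l) * a2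
    + h1 - a1 + a3

theorem dd_symm (i j : Fin n) (h : i ≠ j) (f : Pol k n) : dd j i h.symm f = - dd i j h f := by
  apply mul_left_cancel₀ (X_sub_X_ne h)
  have := mul_dd j i h.symm f
  rw [sw, Equiv.swap_comm] at this
  linear_combination -this + mul_dd i j h f

theorem dd_braid (i j l : Fin n) (hij : i ≠ j) (hjl : j ≠ l) (hil : i ≠ l) (f : Pol k n) :
    dd i j hij (dd j l hjl (dd i j hij f)) = dd j l hjl (dd i j hij (dd j l hjl f)) := by
  have hne := mul_ne_zero (mul_ne_zero (X_sub_X_ne (k := k) hij) (X_sub_X_ne hjl)) (X_sub_X_ne hil)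
  apply mul_left_cancel₀ hne
  have h1 := mul_dd_braid i j l hij hjl hil f
  have h2 := mul_dd_braid l j i hjl.symm hij.symm hil.symm f
  simp only [dd_symm j l hjl, dd_symm i j hij, map_neg, neg_neg] at h2
  have e1 : (sw l j : Pol k n →ₐ[k] _) = sw j l := by rw [sw, Equiv.swap_comm]
  have e2 : (sw j i : Pol k n →ₐ[k] _) = sw i j := by rw [sw, Equiv.swap_comm]
  have e3 : sw i j (sw j l (sw i j f)) = sw j l (sw i j (sw j l f)) := by
    have h1 := Equiv.swap_mul_swap_mul_swap hij hil
    have h2 := Equiv.swap_mul_swap_mul_swap hjl.symm hil.symm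
    rw [Equiv.swap_comm j i, Equiv.swap_comm l j, Equiv.swap_comm i l, ← h1] at h2
    have h3 := congrArg (fun e : Equiv.Perm (Fin n) => rename (R := k) e f) h2
    simpa only [sw, MvPolynomial.rename_rename, Equiv.Perm.coe_mul, Function.comp_assoc] using h3
  rw [e1, e2] at h2
  linear_combination h1 - h2 - e3

theorem sw_dd_comm (i j l m : Fin n) (h : i ≠ j) (hil : i ≠ l) (him : i ≠ m) (hjl : j ≠ l)
    (hjm : j ≠ m) (f : Pol k n) : sw l m (dd i j h f) = dd i j h (sw l m f) := by
  apply mul_left_cancel₀ (X_sub_X_ne h)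
  rw [mul_dd]
  have := congrArg (sw l m) (mul_dd i j h f)
  simp only [map_mul, map_sub, MvPolynomial.rename_X, Equiv.swap_apply_of_ne_of_ne hil him,
    Equiv.swap_apply_of_ne_of_ne hjl hjm] at this
  rw [this, sub_right_inj]
  simp only [sw, MvPolynomial.rename_rename]
  have hc : Equiv.swap l m * Equiv.swap i j = Equiv.swap i j * Equiv.swap l m := by
    apply Equiv.Perm.Disjoint.commute
    intro t
    by_cases h1 : t = i
    · subst h1; exact Or.inl (Equiv.swap_apply_of_ne_of_ne hil him)
    by_cases h2 : t = j
    · subst h2; exact Or.inl (Equiv.swap_apply_of_ne_of_ne hjl hjm)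
    · exact Or.inr (Equiv.swap_apply_of_ne_of_ne h1 h2)
  have h3 := congrArg (fun e : Equiv.Perm (Fin n) => rename (R := k) e f) hc
  simpa only [Equiv.Perm.coe_mul] using h3

theorem dd_comm (i j l m : Fin n) (h : i ≠ j) (h' : l ≠ m) (hil : i ≠ l) (him : i ≠ m)
    (hjl : j ≠ l) (hjm : j ≠ m) (f : Pol k n) :
    dd i j h (dd l m h' f) = dd l m h' (dd i j h f) := by
  apply mul_left_cancel₀ (X_sub_X_ne h')
  rw [mul_dd, sw_dd_comm i j l m h hil him hjl hjm, ← map_sub, ← mul_dd l m h', dd_mul,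
    dd_of_sw_eq i j h (X l - X m)]
  · simp [Equiv.swap_apply_of_ne_of_ne hil.symm hjl.symm,
      Equiv.swap_apply_of_ne_of_ne him.symm hjm.symm]
  · simp [Equiv.swap_apply_of_ne_of_ne hil.symm hjl.symm,
      Equiv.swap_apply_of_ne_of_ne him.symm hjm.symm]

/-- The divided difference operator of the `i`-th and `(i+1)`-st variables. -/
def demazure (i : ℕ) (hi : i + 1 < n) : Pol k n →ₗ[k] Pol k n :=
  dd ⟨i, Nat.lt_of_succ_lt hi⟩ ⟨i + 1, hi⟩ (by simp)

theorem polRelations : NilHeckeRelations (A := Module.End k (Pol k n))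
    (fun i => LinearMap.mulLeft k (X i)) (fun i hi => demazure i hi) where
  sq i hi := LinearMap.ext fun f => by
    rw [Module.End.mul_apply]
    exact dd_of_sw_eq _ _ _ _ (sw_dd _ _ _ f)
  braid i hi := LinearMap.ext fun f => by
    simp only [Module.End.mul_apply, demazure]
    exact dd_braid _ _ _ _ _ (by simp; omega) f
  far i hi j hj h := LinearMap.ext fun f => by
    simp only [Module.End.mul_apply, demazure]
    exact dd_comm _ _ _ _ _ _ (by simp; omega) (by simp; omega) (by simp; omega)
      (by simp; omega) f
  dot_cross i j hj h h' := LinearMap.ext fun f => by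
    have hs : sw ⟨j, Nat.lt_of_succ_lt hj⟩ ⟨j + 1, hj⟩ (X i : Pol k n) = X i := by
      rw [MvPolynomial.rename_X, Equiv.swap_apply_of_ne_of_ne]
      · simpa [Fin.ext_iff] using h
      · simpa [Fin.ext_iff] using h'
    simp [demazure, dd_mul, dd_of_sw_eq _ _ _ _ hs, hs]
  dot_dot i j := LinearMap.ext fun f => by simp; ring
  slide_left i hi := LinearMap.ext fun f => by
    simp [demazure, dd_mul, dd_X_right]
  slide_right i hi := LinearMap.ext fun f => by
    simp [demazure, dd_mul, dd_X_left]

variable (k n) in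
/-- The polynomial representation of `NH_n` on `Pol_n`: `x_i` acts by multiplication by `x_i`,
`δ_i` by the divided difference `f ↦ (f - s_i f) / (x_i - x_{i+1})`. -/
def polRep : NH k n →ₐ[k] Module.End k (Pol k n) := lift _ _ polRelations

/-! ### The subalgebra of polynomials in the dots -/

theorem dots_comm : ∀ a ∈ Set.range (x (n := n) k), ∀ b ∈ Set.range (x (n := n) k),
    a * b = b * a := by
  rintro _ ⟨i, rfl⟩ _ ⟨j, rfl⟩
  exact nilHeckeRelations.dot_dot i j

open scoped IsMulCommutative in
variable (k n) in
/-- The inclusion `Pol_n → NH_n` taking the variable `x_i` to the dot `x_i`. -/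
def polHom : Pol k n →ₐ[k] NH k n :=
  haveI := Algebra.isMulCommutative_adjoin k (dots_comm (k := k) (n := n))
  (Algebra.adjoin k (Set.range (x (n := n) k))).val.comp
    (MvPolynomial.aeval fun i =>
      (⟨x k i, Algebra.subset_adjoin ⟨i, rfl⟩⟩ : Algebra.adjoin k (Set.range (x (n := n) k))))

@[simp] theorem polHom_X (i : Fin n) : polHom k n (X i) = x k i := by
  simp [polHom]

theorem polRep_polHom (f g : Pol k n) : polRep k n (polHom k n f) g = f * g := by
  have : (polRep k n).comp (polHom k n) = Algebra.lmul k (Pol k n) := by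
    apply MvPolynomial.algHom_ext
    intro i
    ext g
    simp [polRep]
  exact LinearMap.congr_fun (DFunLike.congr_fun this f) g

theorem δ_mul_polHom (i : ℕ) (hi : i + 1 < n) (f : Pol k n) :
    δ k i hi * polHom k n f
      = polHom k n (sw ⟨i, Nat.lt_of_succ_lt hi⟩ ⟨i + 1, hi⟩ f) * δ k i hi
        + polHom k n (demazure i hi f) := by
  have R := nilHeckeRelations (k := k) (n := n)
  induction f using MvPolynomial.induction_on with
  | C a =>
    rw [demazure, dd_of_sw_eq _ _ _ _ (by simp)]
    simp [← MvPolynomial.algebraMap_eq, Algebra.commutes]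
  | add f g hf hg => simp only [map_add, mul_add, add_mul, hf, hg]; abel
  | mul_X f l hf =>
    have hl : δ k i hi * x k l
        = polHom k n (sw ⟨i, Nat.lt_of_succ_lt hi⟩ ⟨i + 1, hi⟩ (X l)) * δ k i hi
          + polHom k n (demazure i hi (X l)) := by
      by_cases h : l = ⟨i, Nat.lt_of_succ_lt hi⟩
      · subst h
        rw [demazure, dd_X_left]
        simp [← R.slide_right i hi]
      by_cases h' : l = ⟨i + 1, hi⟩
      · subst h'
        rw [demazure, dd_X_right]
        simp [← R.slide_left i hi]
      · have hs : sw ⟨i, Nat.lt_of_succ_lt hi⟩ ⟨i + 1, hi⟩ (X l : Pol k n) = X l := by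
          rw [MvPolynomial.rename_X, Equiv.swap_apply_of_ne_of_ne h h']
        rw [demazure, dd_of_sw_eq _ _ _ _ hs, hs]
        simpa using (R.dot_cross l i hi (by simpa [Fin.ext_iff] using h)
          (by simpa [Fin.ext_iff] using h')).symm
    rw [map_mul, polHom_X, ← mul_assoc, hf, add_mul, mul_assoc, hl]
    simp only [demazure, dd_mul, map_add, map_mul, polHom_X, mul_add, mul_assoc]
    abel

/-! ### Symmetric polynomials -/

variable (k n) in
/-- `Sym_n'`: the symmetric polynomials with zero constant term. -/
def symPrime : Submodule k (Pol k n) where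
  carrier := {e | e.IsSymmetric ∧ constantCoeff e = 0}
  zero_mem' := ⟨MvPolynomial.IsSymmetric.zero, map_zero _⟩
  add_mem' ha hb := ⟨ha.1.add hb.1, by rw [map_add, ha.2, hb.2, add_zero]⟩
  smul_mem' c e he := ⟨he.1.smul c, by simp [he.2]⟩

theorem polHom_comm {e : Pol k n} (he : e.IsSymmetric) (y : NH k n) :
    y * polHom k n e = polHom k n e * y := by
  have : y ∈ Subalgebra.centralizer k {polHom k n e} := by
    have h : (⊤ : Subalgebra k (NH k n)) ≤ Subalgebra.centralizer k {polHom k n e} := by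
      rw [← adjoin_gen, Algebra.adjoin_le_iff]
      rintro _ ⟨g, rfl⟩
      simp only [SetLike.mem_coe, Subalgebra.mem_centralizer_iff, Set.mem_singleton_iff, forall_eq]
      cases g with
      | dot i =>
        change polHom k n e * x k i = x k i * polHom k n e
        rw [← polHom_X, ← map_mul, mul_comm, map_mul]
      | cross i hi =>
        change polHom k n e * δ k i hi = δ k i hi * polHom k n e
        rw [δ_mul_polHom, demazure, dd_of_sw_eq _ _ _ _ (he _), sw, he]
        simp
    exact h trivial
  exact (Subalgebra.mem_centralizer_iff k |>.1 this _ rfl).symm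

variable (k n) in
/-- The subspace `Sym_n'·NH_n` of `NH_n`. -/
def symNH : Submodule k (NH k n) := (symPrime k n).map (polHom k n).toLinearMap * ⊤

variable (k n) in
/-- `Sym_n'·NH_n` as an ideal; it is two-sided since symmetric polynomials are central. -/
def symIdeal : Ideal (NH k n) where
  toAddSubmonoid := (symNH k n).toAddSubmonoid
  smul_mem' y z hz := by
    change y * z ∈ symNH k n
    replace hz : z ∈ symNH k n := hz
    induction hz using Submodule.mul_induction_on' with
    | mem_mul_mem m hm z hz =>
      obtain ⟨e, he, rfl⟩ := hm
      have : y * ((polHom k n).toLinearMap e * z) = (polHom k n).toLinearMap e * (y * z) := by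
        simp only [AlgHom.toLinearMap_apply, ← mul_assoc, polHom_comm he.1 y]
      rw [this]
      exact Submodule.mul_mem_mul ⟨e, he, rfl⟩ trivial
    | add a _ b _ ha hb => rw [mul_add]; exact add_mem ha hb

theorem mem_symIdeal {y : NH k n} : y ∈ symIdeal k n ↔ y ∈ symNH k n := Iff.rfl

instance : (symIdeal k n).IsTwoSided where
  mul_mem_of_left := by
    intro a b ha
    rw [mem_symIdeal] at ha ⊢
    have := Submodule.mul_mem_mul ha (show b ∈ (⊤ : Submodule k (NH k n)) from trivial)
    rw [symNH, mul_assoc] at this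
    exact (Submodule.mul_le (P := symNH k n).2 fun m hm z _ =>
      Submodule.mul_mem_mul hm (Submodule.mem_top (x := z))) this

variable (k n) in
/-- The quotient algebra `NH_n / (Sym_n'·NH_n)`. -/
abbrev QuotNH : Type _ := NH k n ⧸ symIdeal k n

variable (k n) in
/-- The canonical surjection `π_n`. -/
def π : NH k n →ₐ[k] QuotNH k n := Ideal.Quotient.mkₐ k (symIdeal k n)

theorem π_surjective : Function.Surjective (π k n) := Ideal.Quotient.mk_surjective

theorem π_eq_zero {y : NH k n} : π k n y = 0 ↔ y ∈ symIdeal k n := Ideal.Quotient.eq_zero_iff_mem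

/-! ### The induced differential on the quotient -/

variable (k n) in
/-- The derivation of `Pol_n` with `∂(x_i) = x_i ^ 2`. -/
def polD : Derivation k (Pol k n) (Pol k n) := MvPolynomial.mkDerivation k fun i => X i ^ 2

theorem d_algebraMap (a c : k) : d (n := n) a (algebraMap k _ c) = 0 := by
  simp [d, TrivSqZeroExt.algebraMap_eq_inl']

theorem d_polHom (a : k) (f : Pol k n) : d a (polHom k n f) = polHom k n (polD k n f) := by
  induction f using MvPolynomial.induction_on with
  | C c => simp [← MvPolynomial.algebraMap_eq, d_algebraMap]
  | add f g hf hg => simp [hf, hg]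
  | mul_X f l hf =>
    rw [map_mul, d_mul, hf, polHom_X, d_x, Derivation.leibniz]
    simp only [polD, MvPolynomial.mkDerivation_X, smul_eq_mul, map_add, map_mul, map_pow, polHom_X]
    rw [add_comm, ← polHom_X, ← map_mul, ← map_mul, mul_comm (X l)]

theorem polD_rename (e : Equiv.Perm (Fin n)) (f : Pol k n) :
    polD k n (rename e f) = rename e (polD k n f) := by
  induction f using MvPolynomial.induction_on with
  | C c => simp [← MvPolynomial.algebraMap_eq]
  | add f g hf hg => simp [hf, hg]
  | mul_X f l hf => simp [polD, Derivation.leibniz] at hf ⊢; simp [hf]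

theorem constantCoeff_polD (f : Pol k n) : constantCoeff (polD k n f) = 0 := by
  induction f using MvPolynomial.induction_on with
  | C c => simp [← MvPolynomial.algebraMap_eq]
  | add f g hf hg => simp [hf, hg]
  | mul_X f l hf => simp [polD, Derivation.leibniz]

theorem polD_mem {e : Pol k n} (he : e ∈ symPrime k n) : polD k n e ∈ symPrime k n :=
  ⟨fun σ => by rw [← polD_rename, he.1], constantCoeff_polD e⟩

theorem d_mem (a : k) {y : NH k n} (hy : y ∈ symNH k n) : d a y ∈ symNH k n := by
  induction hy using Submodule.mul_induction_on' with
  | mem_mul_mem m hm z hz =>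
    obtain ⟨e, he, rfl⟩ := hm
    rw [d_mul, AlgHom.toLinearMap_apply, d_polHom]
    exact add_mem (Submodule.mul_mem_mul ⟨_, polD_mem he, rfl⟩ hz)
      (Submodule.mul_mem_mul ⟨e, he, rfl⟩ trivial)
  | add b _ c _ hb hc => rw [map_add]; exact add_mem hb hc

/-- The differential induced by `∂_a` on `NH_n / (Sym_n'·NH_n)`. -/
def dQuot (a : k) : QuotNH k n →ₗ[k] QuotNH k n where
  toFun := Quotient.lift (fun y => π k n (d a y)) fun y z h => by
    rw [← sub_eq_zero, ← map_sub, ← map_sub, π_eq_zero]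
    apply d_mem
    have h' := (Submodule.quotientRel_def _).1 h
    exact h'
  map_add' u v := by
    obtain ⟨y, rfl⟩ := π_surjective u
    obtain ⟨z, rfl⟩ := π_surjective v
    rw [← map_add]
    change π k n (d a (y + z)) = π k n (d a y) + π k n (d a z)
    rw [map_add, map_add]
  map_smul' c u := by
    obtain ⟨y, rfl⟩ := π_surjective u
    rw [← map_smul]
    change π k n (d a (c • y)) = c • π k n (d a y)
    rw [map_smul, map_smul]

@[simp] theorem dQuot_π (a : k) (y : NH k n) : dQuot a (π k n y) = π k n (d a y) := rfl

/-! ### The quotient as the endomorphism algebra of the coinvariants -/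

variable (k n) in
/-- The subspace `Pol_n·Sym_n'` of `Pol_n`. -/
def symPol : Submodule k (Pol k n) := ⊤ * symPrime k n

variable (k n) in
/-- `Ū_n = Pol_n / (Pol_n·Sym_n')`. -/
abbrev Ubar : Type _ := Pol k n ⧸ symPol k n

theorem polRep_mul (y : NH k n) {e : Pol k n} (he : e.IsSymmetric) (f : Pol k n) :
    polRep k n y (f * e) = polRep k n y f * e := by
  rw [mul_comm, ← polRep_polHom, ← Module.End.mul_apply, ← map_mul, polHom_comm he, map_mul,
    Module.End.mul_apply, polRep_polHom, mul_comm]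

theorem polRep_mem (y : NH k n) {f : Pol k n} (hf : f ∈ symPol k n) :
    polRep k n y f ∈ symPol k n := by
  induction hf using Submodule.mul_induction_on' with
  | mem_mul_mem m _ e he =>
    rw [polRep_mul y he.1]
    exact Submodule.mul_mem_mul trivial he
  | add b _ c _ hb hc => rw [map_add]; exact add_mem hb hc

variable (k n) in
/-- The action of `NH_n` on `Ū_n` induced by the polynomial representation. -/
def ubarRep : NH k n →ₐ[k] Module.End k (Ubar k n) :=
  AlgHom.ofLinearMap
    { toFun := fun y => (symPol k n).mapQ (symPol k n) (polRep k n y) fun _ hf => polRep_mem y hf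
      map_add' := fun y z => Submodule.linearMap_qext _ (LinearMap.ext fun f => by simp)
      map_smul' := fun c y => Submodule.linearMap_qext _ (LinearMap.ext fun f => by simp) }
    (Submodule.linearMap_qext _ (LinearMap.ext fun f => by simp)) (fun y z => Submodule.linearMap_qext _ (LinearMap.ext fun f => by simp))

theorem ubarRep_eq_zero (y : NH k n) (hy : y ∈ symIdeal k n) : ubarRep k n y = 0 := by
  rw [mem_symIdeal] at hy
  induction hy using Submodule.mul_induction_on' with
  | mem_mul_mem m hm z _ =>
    obtain ⟨e, he, rfl⟩ := hm
    refine Submodule.linearMap_qext _ (LinearMap.ext fun f => ?_)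
    change (symPol k n).mkQ (polRep k n (polHom k n e * z) f) = 0
    rw [map_mul, Module.End.mul_apply, polRep_polHom, Submodule.mkQ_apply,
      Submodule.Quotient.mk_eq_zero, mul_comm]
    exact Submodule.mul_mem_mul trivial he
  | add b _ c _ hb hc => rw [map_add, hb, hc, add_zero]

variable (k n) in
/-- The canonical homomorphism `NH_n / (Sym_n'·NH_n) → END_k(Ū_n)`. -/
def quotRep : QuotNH k n →ₐ[k] Module.End k (Ubar k n) :=
  Ideal.Quotient.liftₐ (symIdeal k n) (ubarRep k n) ubarRep_eq_zero

theorem quotRep_π_mk (y : NH k n) (f : Pol k n) :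
    quotRep k n (π k n y) (Submodule.Quotient.mk f) = Submodule.Quotient.mk (polRep k n y f) := rfl

variable (k n) in
/-- `U_n^+`: the span of the monomials `x_1^{b_1} ⋯ x_n^{b_n}` with `b_t ≤ n - t`
(for `t = 1, …, n`; the variables are numbered from `0` here). -/
def Uplus : Submodule k (Pol k n) :=
  Submodule.span k {f | ∃ b : Fin n →₀ ℕ, (∀ t : Fin n, b t + t < n) ∧ f = monomial b 1}

/-- `j` is the inclusion `j_n`: `j m` acts on `U_n^+` as `m` acts on `Ū_n`, under the
identification of `U_n^+` with `Ū_n` given by the quotient map `Pol_n → Ū_n`. -/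
def IsInclusion (j : QuotNH k n →ₐ[k] NH k n) : Prop :=
  ∀ (m : QuotNH k n), ∀ u ∈ Uplus k n, polRep k n (j m) u ∈ Uplus k n ∧
    (Submodule.Quotient.mk (polRep k n (j m) u) : Ubar k n)
      = quotRep k n m (Submodule.Quotient.mk u)

/-! ### Gradings -/

/-- The degrees of the generators: `deg x_i = 2`, `deg δ_i = -2`. -/
def Gen.deg : Gen n → ℤ
  | .dot _ => 2
  | .cross _ _ => -2

variable (k n) in
/-- The degree `i` part of `NH_n`: the span of the words of degree `i` in the generators. -/
def grading (i : ℤ) : Submodule k (NH k n) :=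
  Submodule.span k {y | ∃ l : List (Gen n), (l.map Gen.deg).sum = i ∧ y = (l.map gen).prod}

variable (k n) in
/-- The induced grading of the quotient. -/
def gradingQuot (i : ℤ) : Submodule k (QuotNH k n) := (grading k n i).map (π k n).toLinearMap

end PDG

end

noncomputable section

namespace PDG

open MvPolynomial
open scoped TensorProduct

/-! ### The longest element and a resolution of the identity of `NH_n`. -/

section

/-! ### The longest element of a sequence of crossings -/

section Longest
variable {A : Type*} [Ring A]

/-! Everything rests on one identity in `NH_n`, `sum_mon_lng_dualMon`: `1 = ∑_b x^b δ_{w₀} x^b*`.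
Here `x^b` runs over the monomials spanning `U_n^+`, `δ_{w₀}` is the longest product of crossings,
and `x^b*` is a product of coefficients of the polynomials `∏_{t>m} (T - x_t)`. It comes from
letting `∏_{m<t} (x_m ⊗ 1 - 1 ⊗ x_t)` act on `δ_{w₀}` by two-sided multiplication: the factors
belonging to each `m` remove one strand from the longest element, until `1` is left.

Since `δ_i δ_{w₀} = 0`, one has `y f δ_{w₀} = (y·f) δ_{w₀}` for polynomials `f`, hence `y = ∑_b
(y·x^b) δ_{w₀} x^b*` (`eq_sum_polRep`). So the polynomial representation is faithful. The same
identity acting on `Pol_n` gives `f = ∑_b x^b s_b` with symmetric `s_b`, and an interpolation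
argument shows that the `s_b` are unique (`eq_zero_of_sum_mon_mul`). Thus `Pol_n = U_n^+ ⊗ Sym_n`
and `NH_n = Hom_k(U_n^+, Pol_n)`. From this the quotient is `END_k(Ū_n)`, and `j_n ∘ π_n` is
composition with the projection `proj` of `Pol_n` to `U_n^+` along `Pol_n·Sym_n'`.

The differential `∂_1` is the commutator with an operator `D` on `Pol_n` (`repD`), a sum of
commuting terms `x_t^2 d/dx_t - c_t x_t`, with `D^p = 0`. The twist `c_t` is the top exponent of
`x_t` in `U_n^+`, so `D` preserves `U_n^+`. In characteristic `p` the sum defining a homotopy is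
`ad(∂)^{p-1}(h)`, so it suffices to find `H` on `Pol_n` of degree `2 - 2p` with `ad(D)^{p-1}(H) =
proj - 1`. Such an `H` sends `u s` to `u T(s)`, where `T` contracts all of `Pol_n` to the constants;
`T` need not preserve symmetric polynomials. The case `a = -1` follows by the anti-involution fixing
the generators, which exchanges `∂_a` and `∂_{-a}`. -/

/-- The product `t_{m+r-1} ⋯ t_{m+1} t_m`. -/
def chain (t : ℕ → A) (m : ℕ) : ℕ → A
  | 0 => 1
  | r + 1 => t (m + r) * chain t m r

/-- The element of the longest permutation of the strands `m, …, m + r`. -/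
def longest (t : ℕ → A) : ℕ → ℕ → A
  | _, 0 => 1
  | m, r + 1 => chain t m (r + 1) * longest t (m + 1) r

theorem chain_succ' (t : ℕ → A) (m r : ℕ) : chain t m (r + 1) = chain t (m + 1) r * t m := by
  induction r with
  | zero => simp [chain]
  | succ r ih =>
    rw [chain, ih, ← mul_assoc, chain]
    congr 3
    omega

theorem commute_chain {t : ℕ → A} {y : A} {m r : ℕ}
    (h : ∀ i, m ≤ i → i < m + r → Commute y (t i)) : Commute y (chain t m r) := by
  induction r with
  | zero => exact Commute.one_right y
  | succ r ih =>
    exact (h _ (by omega) (by omega)).mul_right (ih fun i hi hi' => h i hi (by omega))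

theorem commute_longest {t : ℕ → A} {y : A} {m r : ℕ}
    (h : ∀ i, m ≤ i → i < m + r → Commute y (t i)) : Commute y (longest t m r) := by
  induction r generalizing m with
  | zero => exact Commute.one_right y
  | succ r ih =>
    exact (commute_chain h).mul_right (ih fun i hi hi' => h i (by omega) (by omega))

/-- The factor `t i` commutes past the chain down to `t (i + 1) * t i`; there one braid move turns
it into `t (i + 1)`, which commutes with the rest. -/
theorem mul_chain {t : ℕ → A}
    (braid : ∀ i, t i * t (i + 1) * t i = t (i + 1) * t i * t (i + 1))
    (far : ∀ i j, i + 1 < j → Commute (t i) (t j)) {m r i : ℕ} (hi : m ≤ i) (hr : i < m + r) :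
    t i * chain t m (r + 1) = chain t m (r + 1) * t (i + 1) := by
  induction r with
  | zero => omega
  | succ r ih =>
    rw [chain]
    rcases Nat.lt_or_ge i (m + r) with h | h
    · rw [← mul_assoc, (far i (m + (r + 1)) (by omega)).eq, mul_assoc, ih h, mul_assoc]
    · obtain rfl : i = m + r := by omega
      have hc : Commute (t (m + r + 1)) (chain t m r) :=
        commute_chain fun l hl hl' => (far l (m + r + 1) (by omega)).symm
      rw [← mul_assoc, chain, ← add_assoc, ← mul_assoc, braid, mul_assoc _ (t (m + r + 1)), hc.eq]
      simp only [mul_assoc]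

/-- The top generator meets its own copy at the head of the chain and squares to zero; any other one
slides through the chain, raising its index, and dies on the shorter longest element. -/
theorem mul_longest {t : ℕ → A} (sq : ∀ i, t i * t i = 0)
    (braid : ∀ i, t i * t (i + 1) * t i = t (i + 1) * t i * t (i + 1))
    (far : ∀ i j, i + 1 < j → Commute (t i) (t j)) {m r i : ℕ} (hi : m ≤ i) (hr : i < m + r) : t i * longest t m r = 0 := by
  induction r generalizing m i with
  | zero => omega
  | succ r ih =>
    rw [longest, ← mul_assoc]
    rcases Nat.lt_or_ge i (m + r) with h | h
    · rw [mul_chain braid far hi h, mul_assoc, ih (by omega) (by omega), mul_zero]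
    · obtain rfl : i = m + r := by omega
      rw [chain, ← mul_assoc, sq, zero_mul, zero_mul]

end Longest

variable {k : Type*} [Field k] {n : ℕ}

variable (k n) in
/-- The crossing `δ_i`, or `0` when there is no such crossing. -/
def cr (i : ℕ) : NH k n := if h : i + 1 < n then δ k i h else 0

theorem cr_of_lt {i : ℕ} (h : i + 1 < n) : cr k n i = δ k i h := dif_pos h

theorem cr_of_not_lt {i : ℕ} (h : ¬ i + 1 < n) : cr k n i = 0 := dif_neg h

theorem cr_sq (i : ℕ) : cr k n i * cr k n i = 0 := by
  by_cases h : i + 1 < n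
  · rw [cr_of_lt h, nilHeckeRelations.sq]
  · rw [cr_of_not_lt h, zero_mul]

/-- Extending the crossings by zero keeps the relations valid for all natural indices, as
`mul_longest` requires: out of range, both sides contain the vanishing `cr k n (i + 1)`. -/
theorem cr_braid (i : ℕ) :
    cr k n i * cr k n (i + 1) * cr k n i = cr k n (i + 1) * cr k n i * cr k n (i + 1) := by
  by_cases h : i + 1 + 1 < n
  · rw [cr_of_lt h, cr_of_lt (Nat.lt_of_succ_lt h), nilHeckeRelations.braid]
  · rw [cr_of_not_lt h]; simp

theorem cr_far (i j : ℕ) (h : i + 1 < j) : Commute (cr k n i) (cr k n j) := by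
  by_cases hj : j + 1 < n
  · rw [cr_of_lt hj, cr_of_lt (by omega : i + 1 < n)]
    exact nilHeckeRelations.far _ _ _ _ (Or.inl h)
  · rw [cr_of_not_lt hj]; exact Commute.zero_right _

theorem cr_mul_longest {m r i : ℕ} (hi : m ≤ i) (hr : i < m + r) :
    cr k n i * longest (cr k n) m r = 0 :=
  mul_longest cr_sq cr_braid cr_far hi hr

/-! ### Moving polynomials through products of crossings -/

theorem commute_cr_polHom {f : Pol k n} {i : ℕ}
    (hf : ∀ hi : i + 1 < n, sw ⟨i, Nat.lt_of_succ_lt hi⟩ ⟨i + 1, hi⟩ f = f) :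
    Commute (polHom k n f) (cr k n i) := by
  by_cases h : i + 1 < n
  · rw [cr_of_lt h]
    refine Commute.symm ?_
    rw [commute_iff_eq, δ_mul_polHom, demazure, dd_of_sw_eq _ _ _ _ (hf h), hf h]
    simp
  · rw [cr_of_not_lt h]; exact Commute.zero_right _

theorem sw_prod_eq (s : Finset (Fin n)) (a b m : Fin n) (hs : a ∈ s ↔ b ∈ s) (ha : m ≠ a)
    (hb : m ≠ b) : sw a b (∏ t ∈ s, (X m - X t : Pol k n)) = ∏ t ∈ s, (X m - X t) := by
  rw [map_prod]
  refine Finset.prod_equiv (Equiv.swap a b) (fun t => ?_) fun t _ => ?_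
  · rcases eq_or_ne t a with rfl | h1
    · simpa using hs
    rcases eq_or_ne t b with rfl | h2
    · simpa using hs.symm
    · rw [Equiv.swap_apply_of_ne_of_ne h1 h2]
  · simp [Equiv.swap_apply_of_ne_of_ne ha hb]

variable (n) in
/-- The strands from `j` on. -/
def tail (j : ℕ) : Finset (Fin n) := Finset.univ.filter fun t => j ≤ (t : ℕ)

@[simp] theorem mem_tail {j : ℕ} {t : Fin n} : t ∈ tail n j ↔ j ≤ (t : ℕ) := by simp [tail]

theorem tail_eq_insert {j : ℕ} (hj : j < n) : tail n j = insert ⟨j, hj⟩ (tail n (j + 1)) := by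
  ext t
  simp only [mem_tail, Finset.mem_insert, Fin.ext_iff]
  omega

theorem tail_eq_empty {j : ℕ} (hj : n ≤ j) : tail n j = ∅ := by
  ext t
  simp
  omega

theorem card_tail (j : ℕ) : (tail n j).card = n - j := by
  rcases Nat.lt_or_ge j n with h | h
  · obtain ⟨r, hr⟩ : ∃ r, n = j + r := ⟨n - j, by omega⟩
    induction r generalizing j with
    | zero => omega
    | succ r ih =>
      rw [tail_eq_insert h, Finset.card_insert_of_notMem (by simp)]
      rcases Nat.lt_or_ge (j + 1) n with h' | h'
      · rw [ih (j + 1) h' (by omega)]; omega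
      · rw [tail_eq_empty h']; simp; omega
  · rw [tail_eq_empty h]; simp; omega

theorem prod_tail {M : Type*} [CommMonoid M] {j : ℕ} (hj : j < n) (f : Fin n → M) :
    ∏ t ∈ tail n j, f t = f ⟨j, hj⟩ * ∏ t ∈ tail n (j + 1), f t := by
  rw [tail_eq_insert hj, Finset.prod_insert (by simp)]

/-- Each crossing `δ_i` of the chain strips the factor `x_m - x_{i+1}`: the other factors are
invariant under `s_i`, the divided difference of this one is `1`, and the term in which `δ_i`
reaches `w` vanishes. -/
theorem chain_mul_prod {m : Fin n} {j r : ℕ} (hm : (m : ℕ) < j) (hr : j + r < n) {w : NH k n}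
    (hw : ∀ i, j ≤ i → i < j + r → cr k n i * w = 0) :
    chain (cr k n) j r * (polHom k n (∏ t ∈ tail n (j + 1), (X m - X t)) * w)
      = polHom k n (∏ t ∈ tail n (j + r + 1), (X m - X t)) * w := by
  induction r with
  | zero => simp [chain]
  | succ r ih =>
    have h : j + r + 1 < n := by omega
    rw [chain, mul_assoc, ih (by omega) fun i hi hi' => hw i hi (by omega), ← mul_assoc,
      cr_of_lt h, δ_mul_polHom, add_mul, mul_assoc, ← cr_of_lt h, hw _ (by omega) (by omega),
      mul_zero, zero_add, prod_tail h, demazure, dd_mul]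
    have hs := sw_prod_eq (k := k) (tail n (j + r + 1 + 1)) ⟨j + r, Nat.lt_of_succ_lt h⟩
      ⟨j + r + 1, h⟩ m (by simp) (by simp [Fin.ext_iff]; omega) (by simp [Fin.ext_iff]; omega)
    have hm' : sw ⟨j + r, Nat.lt_of_succ_lt h⟩ ⟨j + r + 1, h⟩ (X m : Pol k n) = X m := by
      rw [rename_X, Equiv.swap_apply_of_ne_of_ne] <;> simp [Fin.ext_iff] <;> omega
    rw [dd_of_sw_eq _ _ _ _ hs, mul_zero, add_zero, map_sub, dd_of_sw_eq _ _ _ _ hm', dd_X_right]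
    simp [add_assoc]

/-! ### The action of `Pol_n ⊗ Pol_n` on `NH_n` -/

variable (k n) in
/-- Right multiplication by polynomials. -/
def rightMul : Pol k n →ₐ[k] Module.End k (NH k n) :=
  AlgHom.ofLinearMap ((LinearMap.mul k (NH k n)).flip ∘ₗ (polHom k n).toLinearMap)
    (by ext; simp) (fun f g => by
      ext y
      simp only [LinearMap.comp_apply, LinearMap.flip_apply, LinearMap.mul_apply',
        Module.End.mul_apply, AlgHom.toLinearMap_apply]
      rw [mul_comm f g, map_mul, mul_assoc])

variable (k n) in
/-- The two-sided action `(f ⊗ g) • y = f y g`. -/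
def biMul : Pol k n ⊗[k] Pol k n →ₐ[k] Module.End k (NH k n) :=
  Algebra.TensorProduct.lift ((Algebra.lmul k (NH k n)).comp (polHom k n)) (rightMul k n)
    (fun f g => by
      rw [commute_iff_eq]
      ext y
      simp [rightMul, mul_assoc])

@[simp] theorem biMul_tmul (f g : Pol k n) (y : NH k n) :
    biMul k n (f ⊗ₜ g) y = polHom k n f * y * polHom k n g := by
  simp [biMul, rightMul, mul_assoc]

/-- The monic polynomial `∏_{t > m} (T - x_t)` over `Pol_n`. -/
def tailPoly (m : Fin n) : Polynomial (Pol k n) :=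
  ∏ t ∈ tail n (m + 1), (Polynomial.X - Polynomial.C (X t))

variable (k) in
/-- `∏_{t > m} (x_m ⊗ 1 - 1 ⊗ x_t)`. -/
def tailTensor (m : Fin n) : Pol k n ⊗[k] Pol k n :=
  ∏ t ∈ tail n (m + 1), (X m ⊗ₜ 1 - 1 ⊗ₜ X t)

/-- In this form the left factors are powers of `x_m` with exponents in the range of `expos`, and
the right factors are symmetric in the variables after `x_m`, so they commute with crossings of the
later strands. -/
theorem tailTensor_eq_sum (m : Fin n) :
    tailTensor k m = ∑ i ∈ Finset.range (n - m), (X m ^ i) ⊗ₜ (tailPoly (k := k) m).coeff i := by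
  have h1 : tailTensor k m = (tailPoly (k := k) m).eval₂
      (Algebra.TensorProduct.includeRight : Pol k n →ₐ[k] Pol k n ⊗[k] Pol k n).toRingHom
      (X m ⊗ₜ 1) := by
    rw [tailPoly, Polynomial.eval₂_finsetProd]
    simp [tailTensor]
  have h2 : (tailPoly (k := k) m).natDegree < n - m := by
    rw [tailPoly, Polynomial.natDegree_finsetProd_X_sub_C_eq_card, card_tail]
    omega
  rw [h1, Polynomial.eval₂_eq_sum_range' _ h2]
  refine Finset.sum_congr rfl fun i _ => ?_
  simp [Algebra.TensorProduct.tmul_pow]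

theorem sw_coeff_tailPoly (m : Fin n) (l : ℕ) {i : ℕ} (hi : i + 1 < n) (hm : (m : ℕ) < i) :
    sw ⟨i, Nat.lt_of_succ_lt hi⟩ ⟨i + 1, hi⟩ ((tailPoly (k := k) m).coeff l)
      = (tailPoly m).coeff l := by
  have : (tailPoly (k := k) m).map
      (sw (k := k) (⟨i, Nat.lt_of_succ_lt hi⟩ : Fin n) ⟨i + 1, hi⟩).toRingHom = tailPoly m := by
    rw [tailPoly, Polynomial.map_prod]
    refine Finset.prod_equiv (Equiv.swap ⟨i, Nat.lt_of_succ_lt hi⟩ ⟨i + 1, hi⟩) (fun t => ?_)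
      fun t _ => ?_
    · rcases eq_or_ne t ⟨i, Nat.lt_of_succ_lt hi⟩ with rfl | h1
      · simp; omega
      rcases eq_or_ne t ⟨i + 1, hi⟩ with rfl | h2
      · simp; omega
      · rw [Equiv.swap_apply_of_ne_of_ne h1 h2]
    · simp
  conv_rhs => rw [← this]
  simp

theorem biMul_prod_of_commute (s : Finset (Fin n)) (m : Fin n) {y : NH k n}
    (hy : Commute (x k m) y) :
    biMul k n (∏ t ∈ s, (X m ⊗ₜ 1 - 1 ⊗ₜ X t)) y = y * polHom k n (∏ t ∈ s, (X m - X t)) := by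
  induction s using Finset.induction_on with
  | empty => simp
  | insert t s ht ih =>
    rw [Finset.prod_insert ht, Finset.prod_insert ht, map_mul, Module.End.mul_apply, ih, map_sub]
    simp only [LinearMap.sub_apply, biMul_tmul, map_one, mul_one, one_mul, polHom_X]
    rw [← mul_assoc, hy.eq, mul_comm, map_mul, map_sub, polHom_X, polHom_X, mul_sub,
      ← polHom_X, ← polHom_X, mul_assoc y, ← map_mul, mul_comm (X m), map_mul]
    simp only [mul_sub, mul_assoc]

/-- The factors for strand `m` remove that strand from the longest element of the strands `m, …, n -
1`. For `r = 0` the truncated `r - 1` is harmless, as both sides are `1`. -/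
theorem biMul_tailTensor_longest (m : Fin n) {r : ℕ} (hr : (m : ℕ) + r + 1 = n) :
    biMul k n (tailTensor k m) (longest (cr k n) m r) = longest (cr k n) (m + 1) (r - 1) := by
  cases r with
  | zero =>
    rw [tailTensor, tail_eq_empty (by omega)]
    simp [longest]
  | succ r =>
    set w := longest (cr k n) ((m : ℕ) + 1) r with hw
    have hcomm : ∀ l, Commute (polHom k n ((tailPoly (k := k) m).coeff l)) w := fun l =>
      commute_longest fun i hi _ => commute_cr_polHom fun h => sw_coeff_tailPoly m l h (by omega)
    -- The right tensor factors commute with `w`, so only the chain to the left of `w` is affected.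
    have h1 : ∀ C, biMul k n (tailTensor k m) (C * w) = biMul k n (tailTensor k m) C * w := by
      intro C
      rw [tailTensor_eq_sum]
      simp only [map_sum, LinearMap.sum_apply, biMul_tmul, Finset.sum_mul]
      refine Finset.sum_congr rfl fun l _ => ?_
      rw [mul_assoc, mul_assoc, ← (hcomm l).eq]
      simp only [mul_assoc]
    have hm1 : (m : ℕ) + 1 < n := by omega
    have hc : Commute (x k m) (chain (cr k n) (m + 1) r) := by
      refine commute_chain fun i hi _ => ?_
      rw [← polHom_X]
      refine commute_cr_polHom fun h => ?_
      rw [rename_X, Equiv.swap_apply_of_ne_of_ne] <;> simp [Fin.ext_iff] <;> omega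
    -- The factor with `t = m + 1` removes the last crossing `δ_m` by `x_m δ_m - δ_m x_{m+1} = 1`.
    -- What remains commutes with `x_m`, so the other factors become an honest polynomial between
    -- the chain and `w`, which `chain_mul_prod` absorbs.
    have h2 : biMul k n (X m ⊗ₜ 1 - 1 ⊗ₜ X ⟨m + 1, hm1⟩) (chain (cr k n) m (r + 1))
        = chain (cr k n) (m + 1) r := by
      rw [chain_succ', map_sub]
      simp only [LinearMap.sub_apply, biMul_tmul, map_one, mul_one, one_mul, polHom_X]
      rw [← mul_assoc, hc.eq, mul_assoc, mul_assoc, ← mul_sub, cr_of_lt hm1,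
        nilHeckeRelations.slide_left m hm1, mul_one]
    rw [longest, ← hw, h1, tailTensor, prod_tail hm1, mul_comm, map_mul, Module.End.mul_apply, h2,
      biMul_prod_of_commute _ _ hc, mul_assoc,
      chain_mul_prod (by omega) (by omega) fun i hi hi' => cr_mul_longest hi hi',
      tail_eq_empty (by omega)]
    simp

/-! ### The resolution of the identity -/

variable (k n) in
/-- The longest element `δ_{w_0}`. -/
def lng : NH k n := longest (cr k n) 0 (n - 1)

theorem δ_mul_lng (i : ℕ) (hi : i + 1 < n) : δ k i hi * lng k n = 0 := by
  rw [← cr_of_lt]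
  exact cr_mul_longest (by omega) (by omega)

theorem biMul_prod_tailTensor {j : ℕ} (hj : j ≤ n) :
    biMul k n (∏ m ∈ Finset.univ.filter fun m : Fin n => (m : ℕ) < j, tailTensor k m) (lng k n)
      = longest (cr k n) j (n - 1 - j) := by
  induction j with
  | zero => simp [lng]
  | succ j ih =>
    have : (Finset.univ.filter fun m : Fin n => (m : ℕ) < j + 1)
        = insert ⟨j, hj⟩ (Finset.univ.filter fun m : Fin n => (m : ℕ) < j) := by
      ext m
      simp only [Finset.mem_filter_univ, Finset.mem_insert, Fin.ext_iff]
      omega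
    rw [this, Finset.prod_insert (by simp), map_mul, Module.End.mul_apply, ih (by omega),
      biMul_tailTensor_longest ⟨j, hj⟩ (by simp; omega)]
    rw [show n - 1 - j - 1 = n - 1 - (j + 1) by omega]

variable (n) in
/-- The exponents of the monomials that span `U_n^+`. -/
def expos : Finset (Fin n → ℕ) := Fintype.piFinset fun j => Finset.range (n - j)

variable (k) in
/-- The monomial with given exponents. -/
def mon (b : Fin n → ℕ) : Pol k n := ∏ j, X j ^ b j

variable (k) in
/-- The polynomials dual to the monomials `mon b`. -/
def dualMon (b : Fin n → ℕ) : Pol k n := ∏ j, (tailPoly j).coeff (b j)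

theorem prod_tmul {ι : Type*} (s : Finset ι) (f g : ι → Pol k n) :
    ∏ j ∈ s, (f j ⊗ₜ[k] g j) = (∏ j ∈ s, f j) ⊗ₜ ∏ j ∈ s, g j := by
  classical
  induction s using Finset.induction_on with
  | empty => simp [Algebra.TensorProduct.one_def]
  | insert j s hj ih =>
    rw [Finset.prod_insert hj, Finset.prod_insert hj, Finset.prod_insert hj, ih,
      Algebra.TensorProduct.tmul_mul_tmul]

/-- At `j = n` all strands have been removed and `1` is left; the product of the sums in
`tailTensor_eq_sum` expands over the exponents in `expos n`. -/
theorem sum_mon_lng_dualMon :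
    ∑ b ∈ expos n, polHom k n (mon k b) * lng k n * polHom k n (dualMon k b) = 1 := by
  have h := biMul_prod_tailTensor (k := k) (le_refl n)
  rw [show n - 1 - n = 0 by omega, longest] at h
  rw [← h, Finset.filter_true_of_mem (fun m _ => m.2)]
  simp only [tailTensor_eq_sum]
  rw [Finset.prod_univ_sum, map_sum, LinearMap.sum_apply]
  refine Finset.sum_congr rfl fun b _ => ?_
  rw [← biMul_tmul, mon, dualMon]
  congr 2
  exact (prod_tmul (k := k) _ _ _).symm

end

/-! ### Faithfulness, and `Pol_n` as a free module over the symmetric polynomials. -/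

section

variable {k : Type*} [Field k] {n : ℕ}

/-! ### Faithfulness of the polynomial representation -/

theorem polRep_x (i : Fin n) (f : Pol k n) : polRep k n (x k i) f = X i * f := by
  rw [← polHom_X, polRep_polHom]

theorem polRep_δ (i : ℕ) (hi : i + 1 < n) : polRep k n (δ k i hi) = demazure i hi := by
  simp [polRep]

theorem nh_induction {P : NH k n → Prop} (algebraMap : ∀ c, P (algebraMap k _ c))
    (dot : ∀ i, P (x k i)) (cross : ∀ i hi, P (δ k i hi))
    (mul : ∀ y z, P y → P z → P (y * z)) (add : ∀ y z, P y → P z → P (y + z)) (y : NH k n) :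
    P y := by
  have hy : y ∈ Algebra.adjoin k (Set.range (gen (k := k) (n := n))) := by
    rw [adjoin_gen]; trivial
  induction hy using Algebra.adjoin_induction with
  | mem y hy =>
    obtain ⟨g, rfl⟩ := hy
    cases g with
    | dot i => exact dot i
    | cross i hi => exact cross i hi
  | algebraMap c => exact algebraMap c
  | add y z _ _ hy hz => exact add y z hy hz
  | mul y z _ _ hy hz => exact mul y z hy hz

/-- Because every crossing kills `lng` from the left, `NH_n · lng` is a copy of the polynomial
representation. -/
theorem mul_polHom_lng (y : NH k n) (f : Pol k n) :
    y * polHom k n f * lng k n = polHom k n (polRep k n y f) * lng k n := by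
  induction y using nh_induction generalizing f with
  | algebraMap c =>
    rw [AlgHom.commutes, Module.algebraMap_end_apply, map_smul, Algebra.smul_def]
  | dot i => rw [polRep_x, ← polHom_X, map_mul]
  | cross i hi =>
    rw [δ_mul_polHom, polRep_δ, add_mul, mul_assoc, δ_mul_lng, mul_zero, zero_add]
  | mul y z hy hz => rw [mul_assoc y, mul_assoc, hz, ← mul_assoc, hy, map_mul, Module.End.mul_apply]
  | add y z hy hz => rw [add_mul, add_mul, hy, hz, map_add, LinearMap.add_apply, map_add, add_mul]

theorem eq_sum_polRep (y : NH k n) :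
    y = ∑ b ∈ expos n,
      polHom k n (polRep k n y (mon k b)) * lng k n * polHom k n (dualMon k b) := by
  conv_lhs => rw [← mul_one y, ← sum_mon_lng_dualMon, Finset.mul_sum]
  simp only [← mul_assoc, mul_polHom_lng]

theorem eq_of_polRep_mon {y z : NH k n}
    (h : ∀ b ∈ expos n, polRep k n y (mon k b) = polRep k n z (mon k b)) : y = z := by
  rw [eq_sum_polRep y, eq_sum_polRep z]
  exact Finset.sum_congr rfl fun b hb => by rw [h b hb]

theorem polRep_injective : Function.Injective (polRep k n) := fun _ _ h =>
  eq_of_polRep_mon fun _ _ => by rw [h]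

/-! ### Coordinates over the symmetric polynomials -/

theorem isSymmetric_of_sw {f : Pol k n}
    (hf : ∀ i (hi : i + 1 < n), sw ⟨i, Nat.lt_of_succ_lt hi⟩ ⟨i + 1, hi⟩ f = f) :
    f.IsSymmetric := by
  intro σ
  cases n with
  | zero => rw [Subsingleton.elim σ (Equiv.refl _)]; simp
  | succ m =>
    have hσ : σ ∈ Submonoid.closure
        (Set.range fun i : Fin m => Equiv.swap i.castSucc i.succ) := by
      rw [Equiv.Perm.mclosure_swap_castSucc_succ]; trivial
    induction hσ using Submonoid.closure_induction with
    | mem σ hσ =>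
      obtain ⟨i, rfl⟩ := hσ
      exact hf i (by omega)
    | one => simp
    | mul σ τ _ _ hσ hτ => rw [Equiv.Perm.coe_mul, ← rename_rename, hτ, hσ]

/-- All divided differences vanish on the image of `lng`, which is invariance under the adjacent
transpositions. -/
theorem polRep_lng_isSymmetric (f : Pol k n) : (polRep k n (lng k n) f).IsSymmetric := by
  refine isSymmetric_of_sw fun i hi => ?_
  have h := mul_dd ⟨i, Nat.lt_of_succ_lt hi⟩ ⟨i + 1, hi⟩ (by simp) (polRep k n (lng k n) f)
  have h' := congrArg (fun y => polRep k n y f) (δ_mul_lng (k := k) i hi)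
  simp only [map_mul, Module.End.mul_apply, polRep_δ, map_zero, LinearMap.zero_apply] at h'
  rw [demazure] at h'
  rw [h', mul_zero] at h
  exact (sub_eq_zero.1 h.symm).symm

variable (k) in
/-- The coordinates with respect to the basis of `Pol_n` over `Sym_n`. -/
def coord (b : Fin n → ℕ) : Module.End k (Pol k n) :=
  polRep k n (lng k n) ∘ₗ LinearMap.mulLeft k (dualMon k b)

theorem coord_apply (b : Fin n → ℕ) (f : Pol k n) :
    coord k b f = polRep k n (lng k n) (dualMon k b * f) := rfl

theorem coord_isSymmetric (b : Fin n → ℕ) (f : Pol k n) : (coord k b f).IsSymmetric :=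
  polRep_lng_isSymmetric _

theorem coord_mul (b : Fin n → ℕ) (f : Pol k n) {e : Pol k n} (he : e.IsSymmetric) :
    coord k b (f * e) = coord k b f * e := by
  rw [coord_apply, ← mul_assoc, polRep_mul _ he, coord_apply]

theorem sum_mon_mul_coord (f : Pol k n) : ∑ b ∈ expos n, mon k b * coord k b f = f := by
  have h := congrArg (fun y => polRep k n y f) (sum_mon_lng_dualMon (k := k) (n := n))
  simpa [polRep_polHom, coord_apply, mul_assoc] using h

/-- A polynomial of degree at most `n - 1 - j` in the `j`-th variable is determined by its values
at the injective tuples with entries in a set of `n` elements. -/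
theorem eq_zero_of_sum_prod_pow {R : Type*} [CommRing R] [IsDomain R] (n : ℕ) (S : Finset R)
    (hS : n ≤ S.card) (a : (Fin n → ℕ) → R)
    (h : ∀ y : Fin n → R, Function.Injective y → (∀ j, y j ∈ S) →
      ∑ b ∈ expos n, a b * ∏ j, y j ^ b j = 0) : ∀ b ∈ expos n, a b = 0 := by
  classical
  induction n generalizing S with
  | zero =>
    intro b hb
    have := h Fin.elim0 (fun i => i.elim0) fun i => i.elim0
    rw [Finset.sum_eq_single_of_mem b hb fun c _ hc => (hc (Subsingleton.elim _ _)).elim] at this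
    simpa using this
  | succ n ih =>
    -- Split off the first exponent, which is at most `n`; the remaining exponents are exactly those
    -- of `expos n`.
    have key : ∀ y : Fin (n + 1) → R, ∑ b ∈ expos (n + 1), a b * ∏ j, y j ^ b j
        = ∑ b ∈ expos n, (∑ i ∈ Finset.range (n + 1), a (Fin.cons i b) * y 0 ^ i)
          * ∏ j, y (Fin.succ j) ^ b j := by
      intro y
      simp only [Finset.sum_mul]
      rw [Finset.sum_comm, ← Finset.sum_product']
      refine (Finset.sum_nbij' (fun q => Fin.cons q.1 q.2) (fun b => (b 0, Fin.tail b)) ?_ ?_ ?_ ?_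
        ?_).symm
      · rintro ⟨i, b⟩ hq
        simp only [Finset.mem_product, expos, Fintype.mem_piFinset, Finset.mem_range] at hq ⊢
        intro j
        refine Fin.cases ?_ (fun j => ?_) j
        · simpa using hq.1
        · have := hq.2 j; simp; omega
      · intro b hb
        simp only [Finset.mem_product, expos, Fintype.mem_piFinset, Finset.mem_range] at hb ⊢
        refine ⟨by simpa using hb 0, fun j => ?_⟩
        have := hb j.succ
        simp [Fin.tail] at this ⊢
        omega
      · rintro ⟨i, b⟩ _; simp
      · intro b _; simp
      · rintro ⟨i, b⟩ _
        simp [Fin.prod_univ_succ, mul_assoc]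
    -- With the first entry fixed at `y0`, the other entries run over injective tuples in `S.erase
    -- y0`, where the induction hypothesis applies.
    have h1 : ∀ b ∈ expos n, ∀ y0 ∈ S,
        ∑ i ∈ Finset.range (n + 1), a (Fin.cons i b) * y0 ^ i = 0 := by
      intro b hb y0 hy0
      refine ih (S.erase y0) (by rw [Finset.card_erase_of_mem hy0]; omega)
        (fun b => ∑ i ∈ Finset.range (n + 1), a (Fin.cons i b) * y0 ^ i) (fun y hy hyS => ?_) b hb
      have := h (Fin.cons y0 y) ?_ ?_
      · rw [key] at this
        simpa using this
      · rw [Fin.cons_injective_iff]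
        refine ⟨?_, hy⟩
        rintro ⟨j, hj⟩
        exact (Finset.mem_erase.1 (hyS j)).1 hj
      · intro j
        refine Fin.cases (by simpa using hy0) (fun j => ?_) j
        simpa using Finset.mem_of_mem_erase (hyS j)
    intro b hb
    simp only [expos, Fintype.mem_piFinset, Finset.mem_range] at hb
    have hb' : Fin.tail b ∈ expos n := by
      simp only [expos, Fintype.mem_piFinset, Finset.mem_range]
      intro j
      have := hb j.succ
      simp [Fin.tail] at this ⊢
      omega
    -- Degree at most `n`, but at least `n + 1` roots.
    let P : Polynomial R := ∑ i ∈ Finset.range (n + 1),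
      Polynomial.monomial i (a (Fin.cons i (Fin.tail b)))
    have hP : P = 0 := by
      refine Polynomial.eq_zero_of_natDegree_lt_card_of_eval_eq_zero' P S (fun y hy => ?_) ?_
      · simpa [P, Polynomial.eval_finsetSum] using h1 _ hb' y hy
      · refine lt_of_lt_of_le ?_ hS
        rw [Nat.lt_succ_iff]
        refine Polynomial.natDegree_sum_le_of_forall_le _ _ fun i hi => ?_
        exact (Polynomial.natDegree_monomial_le _).trans
          (Nat.lt_succ_iff.1 (Finset.mem_range.1 hi))
    have := congrArg (fun Q => Polynomial.coeff Q (b 0)) hP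
    have hb0 : b 0 < n + 1 := by simpa using hb 0
    simpa [P, Polynomial.finsetSum_coeff, Polynomial.coeff_monomial, hb0] using this

/-- Permuting the variables fixes the symmetric coefficients, so the relation holds with the
variables substituted in any order. These are all the injective tuples in the set of `n` variables,
and interpolation applies. -/
theorem eq_zero_of_sum_mon_mul {s : (Fin n → ℕ) → Pol k n} (hs : ∀ b, (s b).IsSymmetric)
    (h : ∑ b ∈ expos n, mon k b * s b = 0) : ∀ b ∈ expos n, s b = 0 := by
  classical
  refine eq_zero_of_sum_prod_pow n (Finset.univ.image (X : Fin n → Pol k n)) ?_ s fun y hy hyS => ?_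
  · rw [Finset.card_image_of_injective _ (MvPolynomial.X_injective)]; simp
  · simp only [Finset.mem_image, Finset.mem_univ, true_and] at hyS
    choose σ hσ using hyS
    have hσi : Function.Injective σ := fun i j hij => hy (by rw [← hσ, ← hσ, hij])
    let e : Equiv.Perm (Fin n) := Equiv.ofBijective σ (Finite.injective_iff_bijective.1 hσi)
    have := congrArg (rename e) h
    rw [map_sum, map_zero] at this
    rw [← this]
    refine Finset.sum_congr rfl fun b _ => ?_
    rw [map_mul, hs b e, mul_comm, mon, map_prod]
    simp [e, hσ]

/-- Two expansions of `mon k c` with symmetric coefficients, the trivial one and that of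
`sum_mon_mul_coord`, must agree. -/
theorem coord_mon {b c : Fin n → ℕ} (hb : b ∈ expos n) (hc : c ∈ expos n) :
    coord k b (mon k c) = if b = c then 1 else 0 := by
  have h := eq_zero_of_sum_mon_mul
    (s := fun b => coord k b (mon k c) - if b = c then 1 else 0) (fun b => ?_) ?_ b hb
  · exact sub_eq_zero.1 h
  · split_ifs
    · exact (coord_isSymmetric _ _).sub MvPolynomial.IsSymmetric.one
    · exact (coord_isSymmetric _ _).sub MvPolynomial.IsSymmetric.zero
  · simp [mul_sub, sum_mon_mul_coord, hc]

/-! ### The projection to `U_n^+` -/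

theorem mon_eq_monomial (b : Fin n → ℕ) : mon k b = monomial (Finsupp.equivFunOnFinite.symm b) 1 := by
  rw [mon, monomial_eq, Finsupp.prod_fintype _ _ (by simp)]
  simp

theorem Uplus_eq_span : Uplus k n = Submodule.span k (mon k '' (expos n : Set (Fin n → ℕ))) := by
  rw [Uplus]
  congr 1
  ext f
  simp only [Set.mem_ofPred_eq, Set.mem_image, Finset.mem_coe, expos, Fintype.mem_piFinset,
    Finset.mem_range]
  constructor
  · rintro ⟨b, hb, rfl⟩
    exact ⟨b, fun j => by have := hb j; omega, by rw [mon_eq_monomial]; simp⟩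
  · rintro ⟨b, hb, rfl⟩
    refine ⟨Finsupp.equivFunOnFinite.symm b, fun j => ?_, mon_eq_monomial b⟩
    have := hb j
    simp
    omega

theorem mon_mem_Uplus {b : Fin n → ℕ} (hb : b ∈ expos n) : mon k b ∈ Uplus k n := by
  rw [Uplus_eq_span]
  exact Submodule.subset_span ⟨b, hb, rfl⟩

variable (k) in
/-- The constant coefficients of the coordinates. -/
def coord₀ (b : Fin n → ℕ) : Pol k n →ₗ[k] k :=
  (MvPolynomial.lcoeff k 0) ∘ₗ coord k b

theorem coord₀_apply (b : Fin n → ℕ) (f : Pol k n) :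
    coord₀ k b f = constantCoeff (coord k b f) := by
  simp [coord₀, MvPolynomial.constantCoeff_eq]

theorem coord₀_mon {b c : Fin n → ℕ} (hb : b ∈ expos n) (hc : c ∈ expos n) :
    coord₀ k b (mon k c) = if b = c then 1 else 0 := by
  rw [coord₀_apply, coord_mon hb hc]
  split_ifs <;> simp

variable (k n) in
/-- The projection of `Pol_n` to `U_n^+` along `Pol_n·Sym_n'`. -/
def proj : Module.End k (Pol k n) :=
  ∑ b ∈ expos n, (coord₀ k b).smulRight (mon k b)

theorem proj_apply (f : Pol k n) : proj k n f = ∑ b ∈ expos n, coord₀ k b f • mon k b := by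
  simp [proj]

theorem proj_mem (f : Pol k n) : proj k n f ∈ Uplus k n := by
  rw [proj_apply]
  exact sum_mem fun b hb => Submodule.smul_mem _ _ (mon_mem_Uplus hb)

theorem proj_of_mem {f : Pol k n} (hf : f ∈ Uplus k n) : proj k n f = f := by
  rw [Uplus_eq_span] at hf
  induction hf using Submodule.span_induction with
  | mem f hf =>
    obtain ⟨c, hc, rfl⟩ := hf
    rw [proj_apply, Finset.sum_congr rfl fun b hb => by rw [coord₀_mon hb hc]]
    simp [Finset.mem_coe.1 hc]
  | zero => simp
  | add f g _ _ hf hg => rw [map_add, hf, hg]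
  | smul c f _ hf => rw [map_smul, hf]

/-- Then every coefficient in `sum_mon_mul_coord` lies in `Sym_n'`. -/
theorem mem_symPol_of_coord₀ {f : Pol k n} (hf : ∀ b ∈ expos n, coord₀ k b f = 0) :
    f ∈ symPol k n := by
  rw [← sum_mon_mul_coord f]
  exact sum_mem fun b hb => Submodule.mul_mem_mul trivial
    ⟨coord_isSymmetric _ _, by rw [← coord₀_apply, hf b hb]⟩

theorem coord₀_of_mem {f : Pol k n} (hf : f ∈ symPol k n) (b : Fin n → ℕ) : coord₀ k b f = 0 := by
  induction hf using Submodule.mul_induction_on' with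
  | mem_mul_mem f _ e he => rw [coord₀_apply, coord_mul _ _ he.1, map_mul, he.2, mul_zero]
  | add f _ g _ hf hg => rw [map_add, hf, hg, add_zero]

theorem proj_eq_zero {f : Pol k n} : proj k n f = 0 ↔ f ∈ symPol k n := by
  constructor
  · intro h
    refine mem_symPol_of_coord₀ fun b hb => ?_
    have := congrArg (coord₀ k b) h
    rw [proj_apply, map_sum, Finset.sum_congr rfl fun c hc => by
      rw [map_smul, coord₀_mon hb hc], map_zero] at this
    simpa [hb] using this
  · intro h
    rw [proj_apply]
    exact Finset.sum_eq_zero fun b _ => by rw [coord₀_of_mem h, zero_smul]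

theorem sub_proj_mem (f : Pol k n) : f - proj k n f ∈ symPol k n := by
  rw [← proj_eq_zero, map_sub, proj_of_mem (proj_mem f), sub_self]

theorem mk_proj (f : Pol k n) :
    (Submodule.Quotient.mk (proj k n f) : Ubar k n) = Submodule.Quotient.mk f :=
  ((Submodule.Quotient.eq _).2 (sub_proj_mem f)).symm

theorem eq_of_mk_eq {f g : Pol k n} (hf : f ∈ Uplus k n) (hg : g ∈ Uplus k n)
    (h : (Submodule.Quotient.mk f : Ubar k n) = Submodule.Quotient.mk g) : f = g := by
  rw [Submodule.Quotient.eq, ← proj_eq_zero, map_sub, proj_of_mem hf, proj_of_mem hg] at h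
  exact sub_eq_zero.1 h

end

/-! ### `NH_n` as `Hom(U_n^+, Pol_n)`, the inclusion, and the matrix algebra. -/

section

variable {k : Type*} [Field k] {n : ℕ}

/-! ### Elements of `NH_n` as linear maps from `U_n^+` to `Pol_n` -/

/-- The element of `NH_n` whose action takes `mon b` to `F b`. -/
def ofValues (F : (Fin n → ℕ) → Pol k n) : NH k n :=
  ∑ b ∈ expos n, polHom k n (F b) * lng k n * polHom k n (dualMon k b)

/-- By `coord_mon`, `lng * dualMon c` acts on `mon b` as the Kronecker delta. So arbitrary values on
the basis of `U_n^+` are realised in `NH_n`. -/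
theorem polRep_ofValues (F : (Fin n → ℕ) → Pol k n) {b : Fin n → ℕ} (hb : b ∈ expos n) :
    polRep k n (ofValues F) (mon k b) = F b := by
  rw [ofValues, map_sum, LinearMap.sum_apply, Finset.sum_eq_single_of_mem b hb]
  · have := coord_mon (k := k) hb hb
    rw [coord_apply] at this
    simp [polRep_polHom, this]
  · intro c hc hcb
    have := coord_mon (k := k) hc hb
    rw [coord_apply] at this
    simp [polRep_polHom, this, hcb]

/-- The action of a linear endomorphism `T` of `Pol_n` on `NH_n ≅ Hom(U_n^+, Pol_n)` by
composition. -/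
def postComp (T : Module.End k (Pol k n)) : Module.End k (NH k n) where
  toFun y := ofValues fun b => T (polRep k n y (mon k b))
  map_add' y z := by simp [ofValues, add_mul, Finset.sum_add_distrib]
  map_smul' c y := by simp [ofValues, Finset.smul_sum]

theorem polRep_eq_of_mon {y : NH k n} {T : Pol k n →ₗ[k] Pol k n}
    (h : ∀ b ∈ expos n, polRep k n y (mon k b) = T (mon k b)) {u : Pol k n} (hu : u ∈ Uplus k n) :
    polRep k n y u = T u := by
  rw [Uplus_eq_span] at hu
  refine LinearMap.eqOn_span' (f := polRep k n y) (g := T) ?_ hu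
  rintro _ ⟨b, hb, rfl⟩
  exact h b hb

theorem polRep_postComp (T : Module.End k (Pol k n)) (y : NH k n) {u : Pol k n}
    (hu : u ∈ Uplus k n) : polRep k n (postComp T y) u = T (polRep k n y u) :=
  polRep_eq_of_mon (T := T ∘ₗ polRep k n y) (fun _ hb => polRep_ofValues _ hb) hu

theorem eq_of_polRep {y z : NH k n} (h : ∀ u ∈ Uplus k n, polRep k n y u = polRep k n z u) :
    y = z :=
  eq_of_polRep_mon fun _ hb => h _ (mon_mem_Uplus hb)

/-! ### The inclusion -/

variable (k n) in
/-- The composite of the inclusion with the surjection `π_n`. -/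
def incl₀ : NH k n →ₐ[k] NH k n :=
  AlgHom.ofLinearMap (postComp (proj k n))
    (eq_of_polRep fun u hu => by
      rw [polRep_postComp _ _ hu, map_one, Module.End.one_apply, proj_of_mem hu])
    -- Multiplicativity means that `proj` may be inserted between `y` and `z`; this holds because
    -- `y` preserves the kernel `Pol_n·Sym_n'` of `proj`.
    (fun y z => eq_of_polRep fun u hu => by
      rw [polRep_postComp _ _ hu, map_mul, map_mul, Module.End.mul_apply, Module.End.mul_apply,
        polRep_postComp _ _ hu, polRep_postComp _ _ (proj_mem _), ← sub_eq_zero, ← map_sub,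
        ← map_sub, proj_eq_zero]
      exact polRep_mem _ (sub_proj_mem _))

theorem incl₀_apply (y : NH k n) : incl₀ k n y = postComp (proj k n) y := rfl

theorem polRep_incl₀ (y : NH k n) {u : Pol k n} (hu : u ∈ Uplus k n) :
    polRep k n (incl₀ k n y) u = proj k n (polRep k n y u) :=
  polRep_postComp _ _ hu

theorem polRep_mem_symPol {y : NH k n} (hy : ubarRep k n y = 0) (f : Pol k n) :
    polRep k n y f ∈ symPol k n := by
  rw [← Submodule.Quotient.mk_eq_zero]
  exact LinearMap.congr_fun hy (Submodule.Quotient.mk f)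

variable (k n) in
/-- The inclusion `j_n`. -/
def incl : QuotNH k n →ₐ[k] NH k n :=
  Ideal.Quotient.liftₐ (symIdeal k n) (incl₀ k n) fun y hy => eq_of_polRep fun u hu => by
    rw [polRep_incl₀ y hu, map_zero, LinearMap.zero_apply, proj_eq_zero]
    exact polRep_mem_symPol (ubarRep_eq_zero y hy) u

theorem incl_π (y : NH k n) : incl k n (π k n y) = incl₀ k n y := rfl

theorem isInclusion_incl : IsInclusion (incl k n) := by
  intro m u hu
  obtain ⟨y, rfl⟩ := π_surjective m
  rw [incl_π, polRep_incl₀ _ hu, mk_proj, quotRep_π_mk]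
  exact ⟨proj_mem _, rfl⟩

theorem eq_of_mk_polRep {y z : NH k n} (hy : ∀ u ∈ Uplus k n, polRep k n y u ∈ Uplus k n)
    (hz : ∀ u ∈ Uplus k n, polRep k n z u ∈ Uplus k n)
    (h : ∀ u ∈ Uplus k n, (Submodule.Quotient.mk (polRep k n y u) : Ubar k n)
      = Submodule.Quotient.mk (polRep k n z u)) : y = z :=
  eq_of_polRep fun u hu => eq_of_mk_eq (hy u hu) (hz u hu) (h u hu)

theorem IsInclusion.eq_incl {j : QuotNH k n →ₐ[k] NH k n} (hj : IsInclusion j) : j = incl k n :=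
  AlgHom.ext fun m => eq_of_mk_polRep (fun u hu => (hj m u hu).1)
    (fun u hu => (isInclusion_incl m u hu).1)
    fun u hu => (hj m u hu).2.trans (isInclusion_incl m u hu).2.symm

/-! ### The quotient is a matrix algebra -/

theorem polHom_mem_symIdeal {f : Pol k n} (hf : f ∈ symPol k n) : polHom k n f ∈ symIdeal k n := by
  rw [mem_symIdeal]
  induction hf using Submodule.mul_induction_on' with
  | mem_mul_mem f _ e he =>
    rw [mul_comm, map_mul]
    exact Submodule.mul_mem_mul ⟨e, he, rfl⟩ trivial
  | add f _ g _ hf hg => rw [map_add]; exact add_mem hf hg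

/-- If `y` acts as zero on `Ū_n`, each `y·x^b` lies in `Pol_n·Sym_n'`, so every summand of
`eq_sum_polRep` lies in the ideal. -/
theorem quotRep_injective : Function.Injective (quotRep k n) := by
  rw [injective_iff_map_eq_zero]
  intro m hm
  obtain ⟨y, rfl⟩ := π_surjective m
  rw [π_eq_zero, eq_sum_polRep y]
  exact sum_mem fun b _ => Ideal.mul_mem_right _ _ (Ideal.mul_mem_right _ _
    (polHom_mem_symIdeal (polRep_mem_symPol hm _)))

theorem mk_eq_sum (f : Pol k n) : (Submodule.Quotient.mk f : Ubar k n)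
    = ∑ b ∈ expos n, coord₀ k b f • Submodule.Quotient.mk (mon k b) := by
  rw [← mk_proj, proj_apply, ← Submodule.mkQ_apply, map_sum]
  simp

theorem end_Ubar_ext {S T : Module.End k (Ubar k n)}
    (h : ∀ u ∈ Uplus k n, S (Submodule.Quotient.mk u) = T (Submodule.Quotient.mk u)) : S = T := by
  refine LinearMap.ext fun v => ?_
  obtain ⟨f, rfl⟩ := Submodule.Quotient.mk_surjective _ v
  rw [← mk_proj]
  exact h _ (proj_mem f)

theorem quotRep_surjective : Function.Surjective (quotRep k n) := by
  intro S
  choose F hF using fun b : Fin n → ℕ =>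
    Submodule.Quotient.mk_surjective (symPol k n) (S (Submodule.Quotient.mk (mon k b)))
  refine ⟨π k n (ofValues F), ?_⟩
  refine LinearMap.ext fun v => ?_
  obtain ⟨f, rfl⟩ := Submodule.Quotient.mk_surjective _ v
  rw [mk_eq_sum, map_sum, map_sum]
  refine Finset.sum_congr rfl fun b hb => ?_
  rw [map_smul, map_smul, quotRep_π_mk, polRep_ofValues F hb, hF]

theorem π_incl (m : QuotNH k n) : π k n (incl k n m) = m := by
  refine quotRep_injective (end_Ubar_ext fun u hu => ?_)
  rw [quotRep_π_mk]
  exact (isInclusion_incl m u hu).2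

theorem incl_injective : Function.Injective (incl k n) :=
  Function.LeftInverse.injective π_incl

theorem card_expos : (expos n).card = n.factorial := by
  rw [expos, Fintype.card_piFinset]
  simp only [Finset.card_range]
  rw [Fin.prod_univ_eq_prod_range (fun j => n - j) n, ← Finset.prod_range_add_one_eq_factorial,
    ← Finset.prod_range_reflect]
  refine Finset.prod_congr rfl fun j hj => ?_
  have := Finset.mem_range.1 hj
  omega

variable (k n) in
/-- The coordinates of the coinvariants. -/
def ubarEquiv : Ubar k n ≃ₗ[k] (expos n → k) :=
  LinearEquiv.ofBijective
    ((symPol k n).liftQ (LinearMap.pi fun b : expos n => coord₀ k (b : Fin n → ℕ)) fun f hf => by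
      ext b
      exact coord₀_of_mem hf b)
    (by
      constructor
      · rw [← LinearMap.ker_eq_bot, LinearMap.ker_eq_bot']
        intro v hv
        obtain ⟨f, rfl⟩ := Submodule.Quotient.mk_surjective _ v
        rw [Submodule.Quotient.mk_eq_zero]
        exact mem_symPol_of_coord₀ fun b hb => congrFun hv ⟨b, hb⟩
      · intro a
        refine ⟨Submodule.Quotient.mk (∑ c : expos n, a c • mon k (c : Fin n → ℕ)), ?_⟩
        ext b
        change coord₀ k (b : Fin n → ℕ) _ = _
        rw [map_sum, Finset.sum_congr rfl fun c _ => by rw [map_smul, coord₀_mon b.2 c.2]]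
        simp)

theorem finrank_Ubar : Module.finrank k (Ubar k n) = n.factorial := by
  rw [(ubarEquiv k n).finrank_eq, Module.finrank_fintype_fun_eq_card, Fintype.card_coe, card_expos]

theorem nonempty_quotNH_equiv_matrix :
    Nonempty (QuotNH k n ≃ₐ[k] Matrix (Fin n.factorial) (Fin n.factorial) k) := by
  have : Module.Finite k (Ubar k n) := Module.Finite.equiv (ubarEquiv k n).symm
  exact ⟨(AlgEquiv.ofBijective (quotRep k n) ⟨quotRep_injective, quotRep_surjective⟩).trans
    (LinearMap.toMatrixAlgEquiv (Module.finBasisOfFinrankEq k (Ubar k n) finrank_Ubar))⟩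

end

/-! ### Gradings and degrees of operators. -/

section

variable {k : Type*} [Field k] {n : ℕ}

/-! ### The grading of `Pol_n` -/

variable (k n) in
/-- The degree `i` part of `Pol_n`, where the variables have degree `2`. -/
def polGrading (i : ℤ) : Submodule k (Pol k n) :=
  Submodule.span k {f | ∃ b : Fin n → ℕ, 2 * (∑ j, (b j : ℤ)) = i ∧ f = mon k b}

theorem mon_mem (b : Fin n → ℕ) : mon k b ∈ polGrading k n (2 * ∑ j, (b j : ℤ)) :=
  Submodule.subset_span ⟨b, rfl, rfl⟩

theorem mon_add (b c : Fin n → ℕ) : mon k (b + c) = mon k b * mon k c := by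
  simp [mon, pow_add, Finset.prod_mul_distrib]

theorem mon_single (l : Fin n) : mon k (Pi.single l 1) = X l := by
  classical
  rw [mon, Finset.prod_eq_single l] <;> simp +contextual

theorem pol_ext {M : Type*} [AddCommMonoid M] [Module k M] {S T : Pol k n →ₗ[k] M}
    (h : ∀ b, S (mon k b) = T (mon k b)) : S = T := by
  refine (MvPolynomial.basisMonomials (Fin n) k).ext fun s => ?_
  have := h s
  rw [mon_eq_monomial] at this
  simpa using this

theorem X_mem (l : Fin n) : X l ∈ polGrading k n 2 :=
  Submodule.subset_span ⟨Pi.single l 1, by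
    rw [← Nat.cast_sum, Finset.sum_pi_single']; simp, (mon_single l).symm⟩

theorem one_mem_polGrading : (1 : Pol k n) ∈ polGrading k n 0 :=
  Submodule.subset_span ⟨0, by simp, by simp [mon]⟩

theorem map_mem_of_mon {M : Type*} [AddCommMonoid M] [Module k M] {S : Pol k n →ₗ[k] M}
    {N : Submodule k M} {i : ℤ} (h : ∀ b : Fin n → ℕ, 2 * (∑ j, (b j : ℤ)) = i → S (mon k b) ∈ N)
    {f : Pol k n} (hf : f ∈ polGrading k n i) : S f ∈ N := by
  have : polGrading k n i ≤ N.comap S := Submodule.span_le.2 (by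
    rintro _ ⟨b, hb, rfl⟩
    exact h b hb)
  exact this hf

theorem mul_mem_polGrading {i j : ℤ} {f g : Pol k n} (hf : f ∈ polGrading k n i)
    (hg : g ∈ polGrading k n j) : f * g ∈ polGrading k n (i + j) := by
  refine map_mem_of_mon (S := LinearMap.mulRight k g) (fun b hb => ?_) hf
  refine map_mem_of_mon (S := LinearMap.mulLeft k (mon k b)) (fun c hc => ?_) hg
  rw [LinearMap.mulLeft_apply, ← mon_add]
  exact Submodule.subset_span ⟨b + c, by simp [Finset.sum_add_distrib, mul_add, hb, hc], rfl⟩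

theorem prod_mem_polGrading {ι : Type*} (s : Finset ι) {e : ι → ℤ} {f : ι → Pol k n}
    (h : ∀ j ∈ s, f j ∈ polGrading k n (e j)) : ∏ j ∈ s, f j ∈ polGrading k n (∑ j ∈ s, e j) := by
  classical
  induction s using Finset.induction_on with
  | empty => simpa using one_mem_polGrading
  | insert j s hj ih =>
    rw [Finset.prod_insert hj, Finset.sum_insert hj]
    exact mul_mem_polGrading (h j (by simp)) (ih fun l hl => h l (by simp [hl]))

theorem coeff_mon (b : Fin n → ℕ) (c : Fin n →₀ ℕ) :
    coeff c (mon k b) = if b = c then 1 else 0 := by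
  rw [mon_eq_monomial, coeff_monomial]
  congr 1
  rw [eq_iff_iff]
  constructor
  · rintro rfl; simp
  · rintro rfl; simp

theorem coeff_eq_zero_of_mem {i : ℤ} {f : Pol k n} (hf : f ∈ polGrading k n i) {c : Fin n →₀ ℕ}
    (hc : 2 * (∑ j, (c j : ℤ)) ≠ i) : coeff c f = 0 := by
  have : lcoeff k c f ∈ (⊥ : Submodule k k) := map_mem_of_mon (fun b hb => by
    rw [lcoeff_apply, coeff_mon, if_neg, Submodule.mem_bot]
    rintro rfl
    exact hc hb) hf
  simpa using this

/-- `T` has degree `r`. -/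
def HasDeg (r : ℤ) (T : Module.End k (Pol k n)) : Prop :=
  ∀ i, ∀ f ∈ polGrading k n i, T f ∈ polGrading k n (i + r)

theorem hasDeg_of_mon {r : ℤ} {T : Module.End k (Pol k n)}
    (h : ∀ b, T (mon k b) ∈ polGrading k n (2 * (∑ j, (b j : ℤ)) + r)) : HasDeg r T :=
  fun i f hf => map_mem_of_mon (fun b hb => by rw [← hb]; exact h b) hf

theorem HasDeg.comp {r s : ℤ} {S T : Module.End k (Pol k n)} (hS : HasDeg r S) (hT : HasDeg s T) :
    HasDeg (r + s) (S ∘ₗ T) := fun i f hf => by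
  rw [show i + (r + s) = i + s + r by ring]
  exact hS _ _ (hT _ _ hf)

theorem HasDeg.sum {ι : Type*} (s : Finset ι) {r : ℤ} {T : ι → Module.End k (Pol k n)}
    (h : ∀ j ∈ s, HasDeg r (T j)) : HasDeg r (∑ j ∈ s, T j) := fun i f hf => by
  rw [LinearMap.sum_apply]
  exact sum_mem fun j hj => h j hj i f hf

theorem hasDeg_mulLeft {r : ℤ} {g : Pol k n} (hg : g ∈ polGrading k n r) :
    HasDeg r (LinearMap.mulLeft k g) := fun i f hf => by
  rw [LinearMap.mulLeft_apply, add_comm]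
  exact mul_mem_polGrading hg hf

theorem hasDeg_sw (a b : Fin n) : HasDeg 0 (sw (k := k) a b).toLinearMap := by
  refine hasDeg_of_mon fun c => ?_
  have h : sw (k := k) a b (mon k c) = ∏ j, X (Equiv.swap a b j) ^ c j := by simp [mon, map_prod]
  rw [AlgHom.toLinearMap_apply, h, add_zero, Finset.mul_sum]
  refine prod_mem_polGrading _ fun j _ => ?_
  have := prod_mem_polGrading (k := k) (Finset.range (c j)) (e := fun _ => 2)
    (f := fun _ => X (Equiv.swap a b j)) fun _ _ => X_mem _
  simpa [mul_comm] using this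

theorem hasDeg_dd (a b : Fin n) (h : a ≠ b) : HasDeg (-2) (dd (k := k) a b h) := by
  have hX : ∀ l, dd (k := k) a b h (X l) ∈ polGrading k n 0 := by
    intro l
    rcases eq_or_ne l a with rfl | h1
    · rw [dd_X_left]; exact one_mem_polGrading
    rcases eq_or_ne l b with rfl | h2
    · rw [dd_X_right]; exact neg_mem one_mem_polGrading
    · rw [dd_of_sw_eq]
      · exact zero_mem _
      · rw [rename_X, Equiv.swap_apply_of_ne_of_ne h1 h2]
  -- Induction on the total degree: peel off one variable and apply the twisted Leibniz rule.
  have main : ∀ (d : ℕ) (c : Fin n → ℕ), ∑ j, c j = d →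
      dd (k := k) a b h (mon k c) ∈ polGrading k n (2 * d - 2) := by
    intro d
    induction d with
    | zero =>
      intro c hc
      have : c = 0 := by
        ext j
        simpa using (Finset.sum_eq_zero_iff.1 hc) j (Finset.mem_univ j)
      subst this
      rw [dd_of_sw_eq _ _ _ _ (by simp [mon])]
      exact zero_mem _
    | succ d ih =>
      intro c hc
      obtain ⟨l, hl⟩ : ∃ l, c l ≠ 0 := by
        by_contra! hne
        simp [hne] at hc
      obtain ⟨c', rfl⟩ : ∃ c', c = c' + Pi.single l 1 := by
        refine ⟨c - Pi.single l 1, (tsub_add_cancel_of_le ?_).symm⟩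
        intro j
        rcases eq_or_ne j l with rfl | hj
        · simp; omega
        · simp [hj]
      have hc' : ∑ j, c' j = d := by
        simp only [Pi.add_apply, Finset.sum_add_distrib] at hc
        rw [Finset.sum_pi_single'] at hc
        simpa using hc
      rw [mon_add, mon_single, dd_mul]
      refine add_mem ?_ ?_
      · convert mul_mem_polGrading (ih c' hc') (X_mem l) using 2
        push_cast; ring
      · have h2 : sw a b (mon k c') ∈ _ := hasDeg_sw (k := k) a b _ _ (mon_mem c')
        convert mul_mem_polGrading h2 (hX l) using 2
        rw [← hc']; push_cast; ring
  refine hasDeg_of_mon fun c => ?_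
  have := main _ c rfl
  rw [sub_eq_add_neg] at this
  simpa using this

/-! ### The grading of `NH_n` -/

theorem one_mem_grading : (1 : NH k n) ∈ grading k n 0 :=
  Submodule.subset_span ⟨[], by simp, by simp⟩

theorem gen_mem (g : Gen n) : gen g ∈ grading k n g.deg :=
  Submodule.subset_span ⟨[g], by simp, by simp⟩

theorem mul_mem_grading {i j : ℤ} {y z : NH k n} (hy : y ∈ grading k n i)
    (hz : z ∈ grading k n j) : y * z ∈ grading k n (i + j) := by
  have h : grading k n i * grading k n j ≤ grading k n (i + j) := by
    rw [grading, grading, Submodule.span_mul_span, Submodule.span_le]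
    rintro _ ⟨_, ⟨l, hl, rfl⟩, _, ⟨l', hl', rfl⟩, rfl⟩
    exact Submodule.subset_span ⟨l ++ l', by simp [hl, hl'], by simp⟩
  exact h (Submodule.mul_mem_mul hy hz)

instance gradedMonoid_grading : SetLike.GradedMonoid (grading k n) where
  one_mem := one_mem_grading
  mul_mem _ _ _ _ hy hz := mul_mem_grading hy hz

theorem x_mem (i : Fin n) : x k i ∈ grading k n 2 := gen_mem (.dot i)

theorem δ_mem (i : ℕ) (hi : i + 1 < n) : δ k i hi ∈ grading k n (-2) := gen_mem (.cross i hi)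

theorem polHom_mem {i : ℤ} {f : Pol k n} (hf : f ∈ polGrading k n i) :
    polHom k n f ∈ grading k n i := by
  refine map_mem_of_mon (S := (polHom k n).toLinearMap) (fun b hb => ?_) hf
  have key : ∀ (d : ℕ) (c : Fin n → ℕ), ∑ j, c j = d →
      polHom k n (mon k c) ∈ grading k n (2 * d) := by
    intro d
    induction d with
    | zero =>
      intro c hc
      have : c = 0 := by
        ext j
        simpa using (Finset.sum_eq_zero_iff.1 hc) j (Finset.mem_univ j)
      subst this
      simpa [mon] using one_mem_grading
    | succ d ih =>
      intro c hc
      obtain ⟨l, hl⟩ : ∃ l, c l ≠ 0 := by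
        by_contra! hne
        simp [hne] at hc
      obtain ⟨c', rfl⟩ : ∃ c', c = c' + Pi.single l 1 := by
        refine ⟨c - Pi.single l 1, (tsub_add_cancel_of_le ?_).symm⟩
        intro j
        rcases eq_or_ne j l with rfl | hj
        · simp; omega
        · simp [hj]
      have hc' : ∑ j, c' j = d := by
        simp only [Pi.add_apply, Finset.sum_add_distrib] at hc
        rw [Finset.sum_pi_single'] at hc
        simpa using hc
      rw [mon_add, mon_single, map_mul, polHom_X]
      convert mul_mem_grading (ih c' hc') (x_mem l) using 2
      push_cast; ring
  rw [← hb, ← Nat.cast_sum]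
  exact key _ b rfl

theorem hasDeg_polRep {i : ℤ} {y : NH k n} (hy : y ∈ grading k n i) : HasDeg i (polRep k n y) := by
  induction hy using Submodule.span_induction with
  | zero => intro i f _; simp
  | add y z _ _ hy hz =>
    intro i f hf
    rw [map_add]
    exact add_mem (hy i f hf) (hz i f hf)
  | smul c y _ hy =>
    intro i f hf
    rw [map_smul]
    exact Submodule.smul_mem _ _ (hy i f hf)
  | mem y hy =>
    obtain ⟨l, rfl, rfl⟩ := hy
    induction l with
    | nil => intro i f hf; simpa using hf
    | cons g l ih =>
      rw [List.map_cons, List.map_cons, List.sum_cons, List.prod_cons, map_mul]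
      refine HasDeg.comp ?_ ih
      cases g with
      | dot i =>
        have h : polRep k n (gen (.dot i)) = LinearMap.mulLeft k (X i) :=
          LinearMap.ext fun f => polRep_x i f
        rw [h]
        exact hasDeg_mulLeft (X_mem i)
      | cross i hi =>
        have h : polRep k n (gen (.cross i hi)) = demazure i hi := polRep_δ i hi
        rw [h]
        exact hasDeg_dd _ _ _

theorem cr_mem (i : ℕ) : cr k n i ∈ grading k n (-2) := by
  rw [cr]
  split_ifs with h
  · exact δ_mem i h
  · exact zero_mem _

theorem chain_mem (m r : ℕ) : chain (cr k n) m r ∈ grading k n (-2 * r) := by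
  induction r with
  | zero => simpa [chain] using one_mem_grading
  | succ r ih =>
    rw [chain]
    convert mul_mem_grading (cr_mem _) ih using 2
    push_cast; ring

theorem longest_mem (m r : ℕ) :
    longest (cr k n) m r ∈ grading k n (-2 * ∑ j ∈ Finset.range (r + 1), (j : ℤ)) := by
  induction r generalizing m with
  | zero => simpa [longest] using one_mem_grading
  | succ r ih =>
    rw [longest]
    convert mul_mem_grading (chain_mem m (r + 1)) (ih (m + 1)) using 2
    rw [Finset.sum_range_succ _ (r + 1)]
    push_cast; ring

variable (n) in
/-- The sum `0 + 1 + ⋯ + (n - 1)`. -/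
def triangle : ℤ := ∑ j ∈ Finset.range n, (j : ℤ)

theorem lng_mem : lng k n ∈ grading k n (-2 * triangle n) := by
  cases n with
  | zero => simpa [lng, longest, triangle] using one_mem_grading
  | succ n => exact longest_mem 0 n

theorem coeff_prod_X_sub_C_mem (s : Finset (Fin n)) (i : ℕ) :
    (∏ t ∈ s, (Polynomial.X - Polynomial.C (X t : Pol k n))).coeff i
      ∈ polGrading k n (2 * (s.card - i)) := by
  induction s using Finset.induction_on generalizing i with
  | empty =>
    rw [Finset.prod_empty, Polynomial.coeff_one]
    split_ifs with h
    · subst h; simpa using one_mem_polGrading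
    · exact zero_mem _
  | insert t s ht ih =>
    rw [Finset.prod_insert ht, sub_mul, Polynomial.coeff_sub, Polynomial.coeff_C_mul,
      Finset.card_insert_of_notMem ht]
    refine sub_mem ?_ ?_
    · cases i with
      | zero => rw [Polynomial.coeff_X_mul_zero]; exact zero_mem _
      | succ i =>
        rw [Polynomial.coeff_X_mul]
        convert ih i using 2
        push_cast; ring
    · convert mul_mem_polGrading (X_mem t) (ih i) using 2
      push_cast; ring

theorem dualMon_mem (b : Fin n → ℕ) :
    dualMon k b ∈ polGrading k n (2 * triangle n - 2 * ∑ j, (b j : ℤ)) := by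
  have h : dualMon k b ∈ _ := prod_mem_polGrading (k := k) Finset.univ (f := fun j => (tailPoly j).coeff (b j))
    fun j _ => coeff_prod_X_sub_C_mem (tail n (j + 1)) (b j)
  convert h using 2
  rw [← Finset.mul_sum, Finset.sum_sub_distrib, mul_sub]
  congr 2
  simp only [card_tail]
  rw [Fin.sum_univ_eq_sum_range (fun j => ((n - (j + 1) : ℕ) : ℤ)) n, triangle,
    ← Finset.sum_range_reflect]
  refine Finset.sum_congr rfl fun j _ => ?_
  congr 1
  omega

/-- The degree of `lng` cancels the term `2 * triangle n` in the degree of `dualMon k b`. -/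
theorem hasDeg_coord (b : Fin n → ℕ) : HasDeg (-2 * ∑ j, (b j : ℤ)) (coord k b) := by
  have h : HasDeg _ (coord k b) :=
    (hasDeg_polRep (lng_mem (k := k) (n := n))).comp (hasDeg_mulLeft (dualMon_mem b))
  convert h using 1
  ring

theorem coord₀_eq_zero_of_mem {b : Fin n → ℕ} {i : ℤ} {f : Pol k n} (hf : f ∈ polGrading k n i)
    (hb : 2 * (∑ j, (b j : ℤ)) ≠ i) : coord₀ k b f = 0 :=
  coeff_eq_zero_of_mem (hasDeg_coord b i f hf) (by
    simp only [Finsupp.coe_zero, Pi.zero_apply, Nat.cast_zero, Finset.sum_const_zero, mul_zero]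
    omega)

theorem hasDeg_proj : HasDeg 0 (proj k n) := fun i f hf => by
  rw [proj_apply, add_zero]
  refine sum_mem fun b _ => ?_
  by_cases hb : 2 * (∑ j, (b j : ℤ)) = i
  · rw [← hb]
    exact Submodule.smul_mem _ _ (mon_mem b)
  · rw [coord₀_eq_zero_of_mem hf hb, zero_smul]
    exact zero_mem _

theorem postComp_mem {r : ℤ} {T : Module.End k (Pol k n)} (hT : HasDeg r T) {i : ℤ} {y : NH k n}
    (hy : y ∈ grading k n i) : postComp T y ∈ grading k n (i + r) := by
  refine sum_mem fun b _ => ?_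
  have h1 := polHom_mem (hT _ _ (hasDeg_polRep hy _ _ (mon_mem b)))
  convert mul_mem_grading (mul_mem_grading h1 lng_mem) (polHom_mem (dualMon_mem b)) using 2
  ring

theorem incl_mem {i : ℤ} {m : QuotNH k n} (hm : m ∈ gradingQuot k n i) :
    incl k n m ∈ grading k n i := by
  obtain ⟨y, hy, rfl⟩ := hm
  have h := postComp_mem hasDeg_proj hy
  rw [add_zero] at h
  exact h

/-! ### The gradings are direct sum decompositions -/

/-- A nonzero vector in one piece and in the sum of the others would be killed by a functional that
detects it. -/
theorem iSupIndep_of_functionals {V : Type*} [AddCommGroup V] [Module k V]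
    {𝒱 : ℤ → Submodule k V} (h : ∀ i, ∀ v ∈ 𝒱 i, v ≠ 0 →
      ∃ φ : V →ₗ[k] k, φ v ≠ 0 ∧ ∀ j, j ≠ i → ∀ w ∈ 𝒱 j, φ w = 0) : iSupIndep 𝒱 := by
  intro i
  rw [Submodule.disjoint_def]
  intro v hv hv'
  by_contra hne
  obtain ⟨φ, hφ, h0⟩ := h i v hv hne
  have : (⨆ j, ⨆ (_ : j ≠ i), 𝒱 j) ≤ LinearMap.ker φ :=
    iSup_le fun j => iSup_le fun hj w hw => h0 j hj w hw
  exact hφ (this hv')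

/-- By faithfulness some `y·x^b` has a nonzero coefficient at some `x^c`. Taking that coefficient
works, since the degrees of `b` and `c` determine the degree of any `z` it can detect. -/
theorem exists_functional {i : ℤ} {y : NH k n} (hy : y ∈ grading k n i) (hy0 : y ≠ 0) :
    ∃ φ : NH k n →ₗ[k] k, φ y ≠ 0 ∧ ∀ j, j ≠ i → ∀ z ∈ grading k n j, φ z = 0 := by
  obtain ⟨b, -, hb⟩ : ∃ b ∈ expos n, polRep k n y (mon k b) ≠ 0 := by
    by_contra! h
    exact hy0 (eq_of_polRep_mon fun b hb => by rw [h b hb]; simp)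
  obtain ⟨c, hc⟩ := MvPolynomial.ne_zero_iff.1 hb
  refine ⟨lcoeff k c ∘ₗ LinearMap.applyₗ (mon k b) ∘ₗ (polRep k n).toLinearMap, hc,
    fun j hj z hz => ?_⟩
  have h1 : 2 * (∑ l, (c l : ℤ)) = 2 * (∑ l, (b l : ℤ)) + i := by
    by_contra h
    exact hc (coeff_eq_zero_of_mem (hasDeg_polRep hy _ _ (mon_mem b)) h)
  exact coeff_eq_zero_of_mem (hasDeg_polRep hz _ _ (mon_mem b)) (by omega)

theorem iSup_grading : ⨆ i, grading k n i = ⊤ := by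
  rw [eq_top_iff]
  have hmul : ∀ y ∈ ⨆ i, grading k n i, ∀ z ∈ ⨆ i, grading k n i, y * z ∈ ⨆ i, grading k n i := by
    have : (⨆ i, grading k n i) * (⨆ i, grading k n i) ≤ ⨆ i, grading k n i := by
      simp only [Submodule.iSup_mul, Submodule.mul_iSup]
      exact iSup_le fun i => iSup_le fun j => (Submodule.mul_le.2 fun y hy z hz =>
        Submodule.mem_iSup_of_mem _ (mul_mem_grading hy hz))
    exact fun y hy z hz => this (Submodule.mul_mem_mul hy hz)
  rintro y -
  induction y using nh_induction with
  | algebraMap c =>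
    rw [Algebra.algebraMap_eq_smul_one]
    exact Submodule.smul_mem _ _ (Submodule.mem_iSup_of_mem 0 one_mem_grading)
  | dot i => exact Submodule.mem_iSup_of_mem _ (x_mem i)
  | cross i hi => exact Submodule.mem_iSup_of_mem _ (δ_mem i hi)
  | mul y z hy hz => exact hmul y hy z hz
  | add y z hy hz => exact add_mem hy hz

theorem isInternal_grading : DirectSum.IsInternal (grading k n) := by
  rw [DirectSum.isInternal_submodule_iff_iSupIndep_and_iSup_eq_top]
  exact ⟨iSupIndep_of_functionals fun i y hy hy0 => exists_functional hy hy0, iSup_grading⟩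

theorem π_mem {i : ℤ} {y : NH k n} (hy : y ∈ grading k n i) : π k n y ∈ gradingQuot k n i :=
  ⟨y, hy, rfl⟩

theorem isInternal_gradingQuot : DirectSum.IsInternal (gradingQuot k n) := by
  rw [DirectSum.isInternal_submodule_iff_iSupIndep_and_iSup_eq_top]
  constructor
  · refine iSupIndep_of_functionals fun i m hm hm0 => ?_
    -- Independence is pulled back from `NH_n` along the injective inclusion of degree `0`.
    obtain ⟨φ, hφ, h0⟩ := exists_functional (incl_mem hm)
      ((map_ne_zero_iff _ incl_injective).2 hm0)
    exact ⟨φ ∘ₗ (incl k n).toLinearMap, hφ, fun j hj z hz => h0 j hj _ (incl_mem hz)⟩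
  · change ⨆ i, (grading k n i).map (π k n).toLinearMap = ⊤
    rw [← Submodule.map_iSup, iSup_grading, Submodule.map_top, LinearMap.range_eq_top]
    exact π_surjective

instance gradedMonoid_gradingQuot : SetLike.GradedMonoid (gradingQuot k n) where
  one_mem := ⟨1, one_mem_grading, map_one (π k n)⟩
  mul_mem := by
    rintro i j _ _ ⟨y, hy, rfl⟩ ⟨z, hz, rfl⟩
    exact ⟨y * z, mul_mem_grading hy hz, map_mul (π k n) _ _⟩

end

/-! ### Commutators in characteristic `p`, and `∂_1` as a commutator. -/

section

/-! ### Commutators in characteristic `p` -/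

section Commutator
variable {k : Type*} [Field k] (p : ℕ) [hp : Fact p.Prime] [CharP k p]

/-- Pascal's rule: consecutive entries of row `p - 1` add up to an inner entry of row `p`, which is
zero in `k`. -/
theorem choose_pred_prime_cast {m : ℕ} (hm : m < p) : ((p - 1).choose m : k) = (-1) ^ m := by
  induction m with
  | zero => simp
  | succ m ih =>
    have h1 : (p.choose (m + 1) : k) = 0 :=
      (CharP.cast_eq_zero_iff k p _).2 (hp.out.dvd_choose_self (by omega) hm)
    have h2 : p.choose (m + 1) = (p - 1).choose m + (p - 1).choose (m + 1) := by
      rw [← Nat.choose_succ_succ]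
      congr 1
      have := hp.out.pos
      omega
    rw [h2, Nat.cast_add, ih (by omega)] at h1
    rw [pow_succ]
    linear_combination h1

variable {E : Type*} [Ring E] [Algebra k E]

include k in
theorem sub_pow_pred_prime {a b : E} (h : Commute a b) :
    (a - b) ^ (p - 1) = ∑ j ∈ Finset.range p, a ^ (p - 1 - j) * b ^ j := by
  have hp1 : p - 1 + 1 = p := by have := hp.out.pos; omega
  rw [sub_eq_neg_add, (h.symm.neg_left).add_pow, hp1]
  refine Finset.sum_congr rfl fun m hm => ?_
  have hc : ((p - 1).choose m : E) = (-1) ^ m := by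
    have := congrArg (algebraMap k E) (choose_pred_prime_cast (k := k) p (Finset.mem_range.1 hm))
    simpa using this
  rw [hc, neg_pow b, mul_assoc, mul_assoc, ← mul_assoc (b ^ m),
    (h.symm.pow_pow m (p - 1 - m)).eq, mul_assoc,
    ((Commute.neg_one_right (b ^ m)).pow_right m).eq, ← mul_assoc (a ^ _),
    ((Commute.neg_one_right (a ^ (p - 1 - m))).pow_right m).eq, ← mul_assoc, ← mul_assoc,
    ← pow_add, Even.neg_one_pow (Even.add_self m), one_mul]

include k in
theorem add_pow_prime {a b : E} (h : Commute a b) : (a + b) ^ p = a ^ p + b ^ p := by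
  rcases subsingleton_or_nontrivial E with hE | hE
  · exact Subsingleton.elim _ _
  · have : CharP E p := charP_of_injective_algebraMap (algebraMap k E).injective p
    exact add_pow_char_of_commute p h

include k in
theorem sum_pow_prime {ι : Type*} (s : Finset ι) (a : ι → E) (h : ∀ i j, Commute (a i) (a j)) :
    (∑ i ∈ s, a i) ^ p = ∑ i ∈ s, a i ^ p := by
  classical
  induction s using Finset.induction_on with
  | empty => simp [hp.out.ne_zero]
  | insert i s hi ih =>
    rw [Finset.sum_insert hi, Finset.sum_insert hi,
      add_pow_prime (k := k) p (Commute.sum_right _ _ _ fun j _ => h i j), ih]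

variable (k) in
/-- The commutator with `a`. -/
def ad (a : E) : Module.End k E := LinearMap.mulLeft k a - LinearMap.mulRight k a

omit [Fact p.Prime] [CharP k p] in
theorem ad_apply (a b : E) : ad k a b = a * b - b * a := rfl

omit [Fact p.Prime] [CharP k p] in
theorem commute_mulLeft_mulRight (a b : E) :
    Commute (LinearMap.mulLeft k a) (LinearMap.mulRight k b) := LinearMap.ext fun y => by
  simp [mul_assoc]

theorem ad_pow_prime (a b : E) : (ad k a ^ p) b = a ^ p * b - b * a ^ p := by
  have h : ad k a ^ p = LinearMap.mulLeft k a ^ p - LinearMap.mulRight k a ^ p := by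
    rw [eq_sub_iff_add_eq, ← add_pow_prime (k := k) p]
    · simp [ad]
    · exact ((commute_mulLeft_mulRight a a).sub_left (Commute.refl _))
  rw [h, LinearMap.pow_mulLeft, LinearMap.pow_mulRight]
  rfl

/-- This is the sum in `Homotopic` for endomorphisms of one complex, so a homotopy becomes an
equation for `ad(∂)^{p-1}`. -/
theorem ad_pow_pred_prime (a b : E) :
    (ad k a ^ (p - 1)) b = ∑ j ∈ Finset.range p, a ^ (p - 1 - j) * b * a ^ j := by
  rw [ad, sub_pow_pred_prime (k := k) p (commute_mulLeft_mulRight a a), LinearMap.sum_apply]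
  refine Finset.sum_congr rfl fun j _ => ?_
  rw [LinearMap.pow_mulLeft, LinearMap.pow_mulRight]
  simp [mul_assoc]

end Commutator

/-! ### Ladder operators on polynomials -/

variable {k : Type*} [Field k] {n : ℕ}

/-- The linear map with given values on monomials. -/
def monLin (F : (Fin n → ℕ) → Pol k n) : Module.End k (Pol k n) :=
  (MvPolynomial.basisMonomials (Fin n) k).constr k fun s => F s

@[simp] theorem monLin_mon (F : (Fin n → ℕ) → Pol k n) (b : Fin n → ℕ) :
    monLin F (mon k b) = F b := by
  have := (MvPolynomial.basisMonomials (Fin n) k).constr_basis k (fun s => F s)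
    (Finsupp.equivFunOnFinite.symm b)
  rw [MvPolynomial.coe_basisMonomials] at this
  rw [monLin, mon_eq_monomial]
  simpa using this

/-- The operator `x_t^2 d/dx_t - c x_t`. -/
def ladder (t : Fin n) (c : ℕ) : Module.End k (Pol k n) :=
  monLin fun b => ((b t : k) - c) • mon k (b + Pi.single t 1)

@[simp] theorem ladder_mon (t : Fin n) (c : ℕ) (b : Fin n → ℕ) :
    ladder t c (mon k b) = ((b t : k) - c) • mon k (b + Pi.single t 1) := monLin_mon _ _

theorem ladder_pow_mon (t : Fin n) (c m : ℕ) (b : Fin n → ℕ) :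
    (ladder t c ^ m) (mon k b)
      = (∏ l ∈ Finset.range m, ((b t : k) + l - c)) • mon k (b + Pi.single t m) := by
  induction m with
  | zero => simp
  | succ m ih =>
    rw [pow_succ', Module.End.mul_apply, ih, map_smul, ladder_mon, smul_smul,
      Finset.prod_range_succ, add_assoc, ← Pi.single_add]
    simp

theorem exists_cast_add_eq (p : ℕ) [hp : Fact p.Prime] [CharP k p] (b c : ℕ) :
    ∃ r < p, (b : k) + r = c := by
  refine ⟨((c - b : ℤ) % p).toNat, ?_, ?_⟩
  · have h1 := Int.emod_lt_of_pos (c - b : ℤ) (Int.natCast_pos.2 hp.out.pos)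
    have h2 := Int.emod_nonneg (c - b : ℤ) (Int.natCast_ne_zero.2 hp.out.ne_zero)
    omega
  · have h2 := Int.emod_nonneg (c - b : ℤ) (Int.natCast_ne_zero.2 hp.out.ne_zero)
    have h3 := Int.emod_add_mul_ediv (c - b : ℤ) p
    have h4 : ((((c - b : ℤ) % p).toNat : ℤ) : k) = ((c - b : ℤ) : k) := by
      rw [Int.toNat_of_nonneg h2]
      nth_rewrite 2 [← h3]
      push_cast
      simp
    push_cast at h4
    rw [h4]
    ring

/-- The coefficients met along `p` consecutive steps run through all residues, so one of them is
zero. -/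
theorem ladder_pow_prime (p : ℕ) [Fact p.Prime] [CharP k p] (t : Fin n) (c : ℕ) :
    ladder (k := k) t c ^ p = 0 := by
  refine pol_ext fun b => ?_
  obtain ⟨r, hr, h⟩ := exists_cast_add_eq (k := k) p (b t) c
  rw [ladder_pow_mon, Finset.prod_eq_zero (Finset.mem_range.2 hr) (by rw [h, sub_self]), zero_smul,
    LinearMap.zero_apply]

theorem commute_ladder {s t : Fin n} (hst : s ≠ t) (c e : ℕ) :
    Commute (ladder (k := k) s c) (ladder t e) := by
  refine pol_ext fun b => ?_
  simp [hst, hst.symm, smul_smul, mul_comm, add_right_comm]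

/-! ### The differential of the polynomial representation -/

/-- `∑_t (x_t^2 d/dx_t - c_t x_t)`. -/
def twistD (c : Fin n → ℕ) : Module.End k (Pol k n) := ∑ t, ladder t (c t)

theorem twistD_pow_prime (p : ℕ) [Fact p.Prime] [CharP k p] (c : Fin n → ℕ) :
    twistD (k := k) c ^ p = 0 := by
  rw [twistD, sum_pow_prime (k := k) p]
  · exact Finset.sum_eq_zero fun t _ => ladder_pow_prime p t _
  · intro s t
    rcases eq_or_ne s t with rfl | h
    · exact Commute.refl _
    · exact commute_ladder h _ _

theorem polD_mon (b : Fin n → ℕ) :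
    polD k n (mon k b) = ∑ t, (b t : k) • mon k (b + Pi.single t 1) := by
  rw [polD, mon_eq_monomial, mkDerivation_monomial, one_smul,
    Finsupp.sum_fintype _ _ (by simp)]
  refine Finset.sum_congr rfl fun t _ => ?_
  rw [mon_add, mon_single]
  simp only [Finsupp.equivFunOnFinite_symm_apply_apply, smul_eq_mul]
  rcases Nat.eq_zero_or_pos (b t) with h | h
  · simp [h]
  · have h1 : monomial (Finsupp.equivFunOnFinite.symm b - Finsupp.single t 1) (b t : k)
        = (b t : k) • monomial (Finsupp.equivFunOnFinite.symm b - Finsupp.single t 1) (1 : k) := by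
      rw [smul_monomial]; simp
    have h2 : Finsupp.single t 1 ≤ Finsupp.equivFunOnFinite.symm b := by
      rw [Finsupp.single_le_iff]; exact h
    have h3 : mon k b = monomial (Finsupp.equivFunOnFinite.symm b - Finsupp.single t 1) (1 : k)
        * X t := by
      rw [X, monomial_mul, tsub_add_cancel_of_le h2, mon_eq_monomial]; simp
    rw [h1, h3, smul_mul_assoc]
    ring_nf

theorem twistD_apply (c : Fin n → ℕ) (f : Pol k n) :
    twistD c f = polD k n f - (∑ t, (c t : k) • X t) * f := by
  have : twistD c = (polD k n : Pol k n →ₗ[k] Pol k n)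
      - LinearMap.mulLeft k (∑ t, (c t : k) • X t) := by
    refine pol_ext fun b => ?_
    rw [LinearMap.sub_apply, Derivation.coeFn_coe, polD_mon, twistD]
    simp only [LinearMap.sum_apply, ladder_mon, LinearMap.mulLeft_apply, sub_smul,
      Finset.sum_sub_distrib, Finset.sum_mul, smul_mul_assoc, mon_add, mon_single, mul_comm (X _)]
  rw [this]
  rfl

variable (k n) in
/-- The differential of the polynomial representation that preserves `U_n^+`. -/
def repD : Module.End k (Pol k n) := twistD fun t => n - 1 - t

theorem twistD_X_mul (c : Fin n → ℕ) (i : Fin n) (f : Pol k n) :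
    twistD c (X i * f) = X i ^ 2 * f + X i * twistD c f := by
  rw [twistD_apply, twistD_apply, Derivation.leibniz, polD, mkDerivation_X]
  simp only [smul_eq_mul]
  ring

theorem dd_sum_smul_X (c : Fin n → ℕ) (a b : Fin n) (h : a ≠ b) :
    dd a b h (∑ t, (c t : k) • X t) = C ((c a : k) - c b) := by
  rw [map_sum, Finset.sum_eq_add a b h]
  · rw [map_smul, map_smul, dd_X_left, dd_X_right, map_sub, smul_eq_C_mul, smul_eq_C_mul]
    ring
  · intro t _ ht
    rw [map_smul, dd_of_sw_eq, smul_zero]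
    rw [rename_X, Equiv.swap_apply_of_ne_of_ne ht.1 ht.2]
  · simp
  · simp

/-- The right side is the action of `∂_1(δ_i) = 1 - 2 x_i δ_i`. The untwisted derivation contributes
`-(x_i + x_{i+1})` times the divided difference; the linear twist contributes `f` and `-(x_i -
x_{i+1})` times it, as `c_i - c_{i+1} = 1`. -/
theorem repD_demazure (i : ℕ) (hi : i + 1 < n) (f : Pol k n) :
    repD k n (demazure i hi f) - demazure i hi (repD k n f)
      = f - 2 * (X ⟨i, Nat.lt_of_succ_lt hi⟩ * demazure i hi f) := by
  set a : Fin n := ⟨i, Nat.lt_of_succ_lt hi⟩ with ha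
  set b : Fin n := ⟨i + 1, hi⟩ with hb
  have hab : a ≠ b := by simp [ha, hb]
  change repD k n (dd a b hab f) - dd a b hab (repD k n f) = f - 2 * (X a * dd a b hab f)
  set c : Fin n → ℕ := fun t => n - 1 - t with hc
  set L : Pol k n := ∑ t, (c t : k) • X t with hL
  have hcab : (c a : k) - c b = 1 := by
    have : c a = c b + 1 := by simp [hc, ha, hb]; omega
    rw [this]; push_cast; ring
  have h1 := mul_dd a b hab f
  have h2 := congrArg (fun g => polD k n g) h1
  have h3 := mul_dd a b hab (polD k n f)
  have h4 := mul_dd a b hab L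
  rw [hL, dd_sum_smul_X, hcab, ← hL] at h4
  have h5 : dd a b hab (L * f) = f + sw a b L * dd a b hab f := by
    rw [dd_mul, hL, dd_sum_smul_X, hcab, map_one, one_mul]
  have h6 : polD k n (X a - X b : Pol k n) = X a ^ 2 - X b ^ 2 := by
    rw [map_sub, polD, mkDerivation_X, mkDerivation_X]
  beta_reduce at h2
  rw [Derivation.leibniz, h6, map_sub, polD_rename] at h2
  simp only [smul_eq_mul] at h2
  apply mul_left_cancel₀ (X_sub_X_ne (k := k) hab)
  rw [repD, twistD_apply, twistD_apply, ← hL, map_sub, h5]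
  rw [map_one, mul_one] at h4
  linear_combination h2 - h3 + (X a - X b) * dd a b hab f * h4

theorem polRep_d (y : NH k n) (f : Pol k n) :
    polRep k n (d 1 y) f = repD k n (polRep k n y f) - polRep k n y (repD k n f) := by
  induction y using nh_induction generalizing f with
  | algebraMap c => simp [d_algebraMap]
  | dot i =>
    rw [d_x, pow_two, map_mul, Module.End.mul_apply, polRep_x, polRep_x, polRep_x, repD,
      twistD_X_mul]
    ring
  | cross i hi =>
    rw [d_δ, polRep_δ, repD_demazure]
    simp only [one_smul, sub_self, zero_smul, add_zero, map_sub, map_one, map_smul, map_mul,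
      LinearMap.sub_apply, Module.End.one_apply, LinearMap.smul_apply, Module.End.mul_apply,
      polRep_x, polRep_δ]
    rw [one_add_one_eq_two, smul_eq_C_mul, map_ofNat]
  | mul y z hy hz =>
    rw [d_mul, map_add, map_mul, map_mul, map_mul, LinearMap.add_apply]
    simp only [Module.End.mul_apply]
    rw [hy, hz, map_sub]
    abel
  | add y z hy hz =>
    rw [map_add, map_add, map_add, LinearMap.add_apply, LinearMap.add_apply, hy, hz, map_add,
      LinearMap.add_apply]
    abel

/-- In the faithful representation `∂_1` is `ad(repD)`, whose `p`-th power is the commutator with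
`repD ^ p = 0`. -/
theorem d_one_pow_prime (p : ℕ) [Fact p.Prime] [CharP k p] : d (k := k) (n := n) 1 ^ p = 0 := by
  have h : ∀ m (y : NH k n), polRep k n ((d 1 ^ m) y) = (ad k (repD k n) ^ m) (polRep k n y) := by
    intro m
    induction m with
    | zero => intro y; simp
    | succ m ih =>
      intro y
      rw [pow_succ', pow_succ', Module.End.mul_apply, Module.End.mul_apply, ← ih, ad_apply]
      refine LinearMap.ext fun f => ?_
      rw [polRep_d]
      rfl
  refine LinearMap.ext fun y => polRep_injective ?_
  rw [h, ad_pow_prime, repD, twistD_pow_prime]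
  simp

/-- The twist is the largest exponent allowed for `x_t`, so the coefficient vanishes exactly where
raising the exponent would leave the range. -/
theorem repD_mem_Uplus {u : Pol k n} (hu : u ∈ Uplus k n) : repD k n u ∈ Uplus k n := by
  have : Uplus k n ≤ (Uplus k n).comap (repD k n) := by
    conv_lhs => rw [Uplus_eq_span]
    rw [Submodule.span_le]
    rintro _ ⟨b, hb, rfl⟩
    rw [SetLike.mem_coe, Submodule.mem_comap, repD, twistD, LinearMap.sum_apply]
    refine sum_mem fun t _ => ?_
    rw [ladder_mon]
    have hb' := Fintype.mem_piFinset.1 (Finset.mem_coe.1 hb)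
    simp only [Finset.mem_range] at hb'
    by_cases ht : b t = n - 1 - t
    · rw [ht, sub_self, zero_smul]; exact zero_mem _
    · refine Submodule.smul_mem _ _ (mon_mem_Uplus ?_)
      rw [expos, Fintype.mem_piFinset]
      intro j
      rw [Finset.mem_range]
      rcases eq_or_ne j t with rfl | hj
      · have := hb' j; simp; omega
      · simpa [hj] using hb' j
  exact this hu

theorem repD_mul (f e : Pol k n) : repD k n (f * e) = repD k n f * e + f * polD k n e := by
  rw [repD, twistD_apply, twistD_apply, Derivation.leibniz]
  simp only [smul_eq_mul]
  ring

theorem repD_mem_symPol {f : Pol k n} (hf : f ∈ symPol k n) : repD k n f ∈ symPol k n := by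
  induction hf using Submodule.mul_induction_on' with
  | mem_mul_mem f _ e he =>
    rw [repD_mul]
    exact add_mem (Submodule.mul_mem_mul trivial he) (Submodule.mul_mem_mul trivial (polD_mem he))
  | add f _ g _ hf hg => rw [map_add]; exact add_mem hf hg

/-- `repD` preserves both the image `U_n^+` and the kernel `Pol_n·Sym_n'` of the projection. -/
theorem repD_proj (f : Pol k n) : repD k n (proj k n f) = proj k n (repD k n f) := by
  rw [← proj_of_mem (repD_mem_Uplus (proj_mem f)), ← sub_eq_zero, ← map_sub, ← map_sub,
    proj_eq_zero, ← neg_sub, map_neg]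
  exact neg_mem (repD_mem_symPol (sub_proj_mem f))

theorem d_postComp (T : Module.End k (Pol k n)) (y : NH k n) :
    d 1 (postComp T y) = postComp (ad k (repD k n) T) y + postComp T (d 1 y) := by
  refine eq_of_polRep fun u hu => ?_
  rw [map_add, LinearMap.add_apply, polRep_d, polRep_postComp _ _ hu,
    polRep_postComp _ _ (repD_mem_Uplus hu), polRep_postComp _ _ hu, polRep_postComp _ _ hu,
    polRep_d, ad_apply, map_sub]
  simp only [LinearMap.sub_apply, Module.End.mul_apply]
  abel

/-- This reduces a homotopy on `NH_n` to an equation between operators on `Pol_n`. -/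
theorem ad_pow_postComp (T : Module.End k (Pol k n)) (m : ℕ) :
    (ad k (d (n := n) (1 : k)) ^ m) (postComp T) = postComp ((ad k (repD k n) ^ m) T) := by
  induction m with
  | zero => rfl
  | succ m ih =>
    rw [pow_succ', pow_succ', Module.End.mul_apply, Module.End.mul_apply, ih, ad_apply]
    refine LinearMap.ext fun y => ?_
    rw [LinearMap.sub_apply, Module.End.mul_apply, Module.End.mul_apply, d_postComp]
    abel

theorem d_incl (m : QuotNH k n) : d 1 (incl k n m) = incl k n (dQuot 1 m) := by
  obtain ⟨y, rfl⟩ := π_surjective m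
  rw [dQuot_π, incl_π, incl_π, incl₀_apply, incl₀_apply, d_postComp]
  have : ad k (repD k n) (proj k n) = 0 := by
    rw [ad_apply, sub_eq_zero]
    exact LinearMap.ext repD_proj
  rw [this]
  have h0 : postComp (0 : Module.End k (Pol k n)) y = 0 := by simp [postComp, ofValues]
  rw [h0, zero_add]

theorem d_mem_grading (a : k) {i : ℤ} {y : NH k n} (hy : y ∈ grading k n i) :
    d a y ∈ grading k n (i + 2) := by
  induction hy using Submodule.span_induction with
  | zero => rw [map_zero]; exact zero_mem _
  | add y z _ _ hy hz => rw [map_add]; exact add_mem hy hz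
  | smul c y _ hy => rw [map_smul]; exact Submodule.smul_mem _ _ hy
  | mem y hy =>
    obtain ⟨l, rfl, rfl⟩ := hy
    induction l with
    | nil =>
      have := d_algebraMap (n := n) a 1
      rw [map_one] at this
      rw [List.map_nil, List.map_nil, List.prod_nil, this]
      exact zero_mem _
    | cons g l ih =>
      rw [List.map_cons, List.map_cons, List.sum_cons, List.prod_cons, d_mul]
      have hg : d a (gen g) ∈ grading k n (g.deg + 2) := by
        cases g with
        | dot i =>
          change d a (x k i) ∈ _
          rw [d_x, pow_two]
          exact mul_mem_grading (x_mem i) (x_mem i)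
        | cross i hi =>
          change d a (δ k i hi) ∈ grading k n (-2 + 2)
          rw [d_δ, neg_add_cancel]
          have hx : ∀ j, x k j * δ k i hi ∈ grading k n 0 := fun j => by
            have h := mul_mem_grading (x_mem (k := k) j) (δ_mem i hi)
            rwa [add_neg_cancel] at h
          exact add_mem (sub_mem (Submodule.smul_mem _ _ one_mem_grading)
            (Submodule.smul_mem _ _ (hx _))) (Submodule.smul_mem _ _ (hx _))
      have hl : (l.map gen).prod ∈ grading k n (l.map Gen.deg).sum :=
        Submodule.subset_span ⟨l, rfl, rfl⟩
      refine add_mem ?_ ?_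
      · have h := mul_mem_grading hg hl
        rwa [add_right_comm] at h
      · have h := mul_mem_grading (gen_mem g) ih
        rwa [← add_assoc] at h

end

/-! ### The homotopy between `j_n ∘ π_n` and the identity. -/

section

variable {k : Type*} [Field k] {n : ℕ}

/-! ### A homotopy on polynomials -/

theorem ad_pow_mul_of_commute {E : Type*} [Ring E] [Algebra k E] {a q : E} (h : Commute a q)
    (b : E) (m : ℕ) : (ad k a ^ m) (b * q) = (ad k a ^ m) b * q := by
  induction m with
  | zero => rfl
  | succ m ih =>
    rw [pow_succ', Module.End.mul_apply, Module.End.mul_apply, ih, ad_apply, ad_apply, sub_mul,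
      mul_assoc, mul_assoc, mul_assoc, h.eq]

theorem ad_add_pow_of_commute {E : Type*} [Ring E] [Algebra k E] {a r b : E} (ha : Commute r a)
    (hb : Commute r b) (m : ℕ) :
    (ad k (a + r) ^ m) b = (ad k a ^ m) b ∧ Commute r ((ad k a ^ m) b) := by
  induction m with
  | zero => exact ⟨rfl, hb⟩
  | succ m ih =>
    rw [pow_succ', pow_succ', Module.End.mul_apply, Module.End.mul_apply, ih.1]
    constructor
    · rw [ad_apply, ad_apply, add_mul, mul_add, ih.2.eq]
      abel
    · exact (ha.mul_right ih.2).sub_right (ih.2.mul_right ha)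

/-- The operator that lowers the exponent of `x_t` by `p - 1` when it is a positive multiple of
`p`. -/
def lower (p : ℕ) (t : Fin n) : Module.End k (Pol k n) :=
  monLin fun b => if p ∣ b t ∧ b t ≠ 0 then mon k (b - Pi.single t (p - 1)) else 0

theorem lower_mon (p : ℕ) (t : Fin n) (b : Fin n → ℕ) : lower p t (mon k b)
    = if p ∣ b t ∧ b t ≠ 0 then mon k (b - Pi.single t (p - 1)) else 0 := monLin_mon _ _

theorem commute_ladder_lower (p : ℕ) {s t : Fin n} (hst : s ≠ t) (c : ℕ) :
    Commute (ladder (k := k) s c) (lower p t) := by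
  refine pol_ext fun b => ?_
  rw [Module.End.mul_apply, Module.End.mul_apply, lower_mon, ladder_mon, map_smul, lower_mon]
  have h1 : (b + Pi.single s 1 : Fin n → ℕ) t = b t := by simp [hst.symm]
  rw [h1]
  split_ifs with h
  · rw [ladder_mon]
    congr 2
    · simp [hst]
    · ext j
      rcases eq_or_ne j s with rfl | hj
      · simp [hst]
      · simp [hj]
  · simp

theorem prod_range_cast_sub (r : ℕ) :
    ∏ l ∈ Finset.range r, ((l : k) - r) = (-1) ^ r * (r.factorial : k) := by
  rw [← Finset.prod_range_reflect, ← Finset.prod_range_add_one_eq_factorial, Nat.cast_prod,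
    ← Finset.card_range r, ← Finset.prod_const, Finset.card_range, ← Finset.prod_mul_distrib]
  refine Finset.prod_congr rfl fun l hl => ?_
  have hl' := Finset.mem_range.1 hl
  have h : ((r - 1 - l : ℕ) : k) + (l + 1) = r := by
    rw [← Nat.cast_add_one, ← Nat.cast_add]
    congr 1
    omega
  push_cast
  linear_combination h

variable (p : ℕ) [hp : Fact p.Prime] [CharP k p]

theorem factorial_pred_prime_cast : ((p - 1).factorial : k) = -1 := by
  have h := congrArg (ZMod.castHom (dvd_refl p) k) (ZMod.wilsons_lemma p)
  rwa [map_natCast, map_neg, map_one] at h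

/-- The sign is `(p - 1).choose r` in `k`, so the product is `(p - 1)!`, which is `-1` by Wilson. -/
theorem factorial_mul_factorial_cast {r : ℕ} (hr : r < p) :
    (-1) ^ r * (r.factorial : k) * ((p - 1 - r).factorial : k) = -1 := by
  rw [← choose_pred_prime_cast (k := k) p hr, ← factorial_pred_prime_cast (k := k) p,
    ← Nat.choose_mul_factorial_mul_factorial (show r ≤ p - 1 by omega)]
  push_cast
  rfl

/-- Only the summand that first climbs `r` steps, to the next multiple of `p`, survives; lowering by
`p - 1` and climbing the other `p - 1 - r` steps returns to `b`. -/
theorem ad_pow_lower_mon (t : Fin n) {b : Fin n → ℕ} (hb : b t ≠ 0) :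
    (ad k (ladder (k := k) t 0) ^ (p - 1)) (lower p t) (mon k b) = - mon k b := by
  obtain ⟨r, hr, h⟩ := exists_cast_add_eq (k := k) p (b t) 0
  have hp1 := hp.out.one_lt
  have hdvd : p ∣ b t + r := by
    rw [← CharP.cast_eq_zero_iff k p]
    push_cast
    simpa using h
  have hle : p ≤ b t + r := Nat.le_of_dvd (by omega) hdvd
  rw [ad_pow_pred_prime, LinearMap.sum_apply, Finset.sum_eq_single_of_mem r (Finset.mem_range.2 hr)]
  · rw [Module.End.mul_apply, Module.End.mul_apply, ladder_pow_mon, map_smul, lower_mon, if_pos,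
      map_smul, ladder_pow_mon, smul_smul]
    · have e1 : b + Pi.single t r - Pi.single t (p - 1) + Pi.single t (p - 1 - r) = b := by
        ext j
        rcases eq_or_ne j t with rfl | hj
        · simp; omega
        · simp [hj]
      have e2 : ∏ l ∈ Finset.range r, ((b t : k) + l - (0 : ℕ)) = (-1) ^ r * (r.factorial : k) := by
        rw [← prod_range_cast_sub]
        refine Finset.prod_congr rfl fun l _ => ?_
        linear_combination h
      -- The lowered exponent is congruent to `1`, so the remaining coefficients are `1, 2, …, p - 1
      -- - r`.
      have e3 : ∏ l ∈ Finset.range (p - 1 - r),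
          (((b + Pi.single t r - Pi.single t (p - 1) : Fin n → ℕ) t : k) + l - (0 : ℕ))
          = ((p - 1 - r).factorial : k) := by
        rw [← Finset.prod_range_add_one_eq_factorial, Nat.cast_prod]
        refine Finset.prod_congr rfl fun l _ => ?_
        have h1 : ((b + Pi.single t r - Pi.single t (p - 1) : Fin n → ℕ) t) + p = b t + r + 1 := by
          simp; omega
        have h2 := congrArg (Nat.cast : ℕ → k) h1
        rw [Nat.cast_add, CharP.cast_eq_zero k p] at h2
        push_cast at h2 h ⊢
        linear_combination h2 + h
      rw [e1, e2, e3, factorial_mul_factorial_cast p hr, neg_one_smul]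
    · simpa using ⟨hdvd, fun h => (hb h).elim⟩
  · intro j hj hjr
    rw [Module.End.mul_apply, Module.End.mul_apply, ladder_pow_mon, map_smul, lower_mon, if_neg,
      smul_zero, map_zero]
    rintro ⟨hd, -⟩
    refine hjr (CharP.natCast_injOn_Iio k p (Finset.mem_range.1 hj) hr ?_)
    have hd' : p ∣ b t + j := by simpa using hd
    rw [← CharP.cast_eq_zero_iff k p] at hd'
    push_cast at hd' h
    linear_combination hd' - h

theorem twistD_zero : twistD (k := k) (n := n) 0 = (polD k n : Pol k n →ₗ[k] Pol k n) :=
  LinearMap.ext fun f => by simp [twistD_apply]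

/-- The projection to the monomials in which `x_t` is the first variable that occurs. -/
def firstVar (t : Fin n) : Module.End k (Pol k n) :=
  monLin fun b => if b t ≠ 0 ∧ ∀ s < t, b s = 0 then mon k b else 0

theorem firstVar_mon (t : Fin n) (b : Fin n → ℕ) :
    firstVar t (mon k b) = if b t ≠ 0 ∧ ∀ s < t, b s = 0 then mon k b else 0 := monLin_mon _ _

/-- Untwisted ladder operators never introduce a new variable: the coefficient `b s` vanishes when
`x_s` is absent. -/
theorem commute_twistD_firstVar (t : Fin n) : Commute (twistD (k := k) 0) (firstVar t) := by
  refine pol_ext fun b => ?_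
  rw [Module.End.mul_apply, Module.End.mul_apply, firstVar_mon]
  have h : ∀ s, firstVar t (ladder s ((0 : Fin n → ℕ) s) (mon k b))
      = if b t ≠ 0 ∧ ∀ s < t, b s = 0 then ladder s ((0 : Fin n → ℕ) s) (mon k b) else 0 := by
    intro s
    rw [ladder_mon, map_smul, firstVar_mon]
    rcases Nat.eq_zero_or_pos (b s) with h0 | h0
    · simp [h0]
    · have hiff : ∀ j, (b + Pi.single s 1 : Fin n → ℕ) j = 0 ↔ b j = 0 := by
        intro j
        rcases eq_or_ne j s with rfl | hj
        · simp; omega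
        · simp [hj]
      simp only [ne_eq, hiff, smul_ite, smul_zero]
  simp only [twistD, LinearMap.sum_apply, map_sum, h]
  split_ifs with h1
  · rfl
  · simp

/-- A homotopy between the identity of `Pol_n` and the projection to the constants. -/
def polHomotopy : Module.End k (Pol k n) := ∑ t, lower p t * firstVar t

-- The ladder operators of the other variables commute with `lower p t`, so they drop out of the
-- iterated commutator.
omit hp [CharP k p] in
theorem ad_pow_lower (t : Fin n) : (ad k (twistD (k := k) (n := n) 0) ^ (p - 1)) (lower p t)
    = (ad k (ladder (k := k) t 0) ^ (p - 1)) (lower p t) := by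
  have h : twistD (k := k) (n := n) 0 = ladder t 0 + ∑ s ∈ Finset.univ.erase t, ladder s 0 :=
    (Finset.add_sum_erase _ _ (Finset.mem_univ t)).symm
  rw [h]
  refine (ad_add_pow_of_commute ?_ ?_ _).1
  · exact Commute.sum_left _ _ _ fun s hs => commute_ladder (Finset.ne_of_mem_erase hs) _ _
  · exact Commute.sum_left _ _ _ fun s hs => commute_ladder_lower p (Finset.ne_of_mem_erase hs) _

/-- Each nonconstant monomial is seen by a single summand, that of its first variable, and there
`ad_pow_lower_mon` gives `-1`. -/
theorem ad_pow_polHomotopy_mon (b : Fin n → ℕ) :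
    (ad k (twistD (k := k) 0) ^ (p - 1)) (polHomotopy p) (mon k b)
      = if b = 0 then 0 else - mon k b := by
  rw [polHomotopy, map_sum, LinearMap.sum_apply]
  simp only [ad_pow_mul_of_commute (commute_twistD_firstVar _), ad_pow_lower, Module.End.mul_apply,
    firstVar_mon]
  split_ifs with hb
  · subst hb; simp
  · have hne : (Finset.univ.filter fun t => b t ≠ 0).Nonempty := by
      by_contra h
      rw [Finset.not_nonempty_iff_eq_empty, Finset.filter_eq_empty_iff] at h
      exact hb (funext fun t => by simpa using h (Finset.mem_univ t))
    have h1 := Finset.min'_mem _ hne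
    rw [Finset.mem_filter_univ] at h1
    rw [Finset.sum_eq_single (Finset.min' _ hne)]
    · rw [if_pos, ad_pow_lower_mon p _ h1]
      refine ⟨h1, fun s hs => ?_⟩
      by_contra h0
      exact absurd (Finset.min'_le _ s (by simpa using h0)) (not_le.2 hs)
    · intro t _ ht
      rw [if_neg, map_zero]
      rintro ⟨h2, h3⟩
      have h4 := Finset.min'_le _ t (by simpa using h2 : t ∈ Finset.univ.filter fun t => b t ≠ 0)
      exact h1 (h3 _ (lt_of_le_of_ne h4 ht.symm))
    · simp

omit [CharP k p] in
theorem hasDeg_polHomotopy : HasDeg (2 - 2 * (p : ℤ)) (polHomotopy (k := k) (n := n) p) := by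
  refine HasDeg.sum _ fun t _ => hasDeg_of_mon fun b => ?_
  rw [Module.End.mul_apply, firstVar_mon]
  split_ifs
  · rw [lower_mon]
    split_ifs with h
    · have hp1 := hp.out.pos
      -- The exponent is at least `p`, so the truncated subtraction of `p - 1` is exact.
      have hle := Nat.le_of_dvd (by omega) h.1
      have h1 : ∑ j, (((b - Pi.single t (p - 1) : Fin n → ℕ) j : ℕ) : ℤ)
          = ∑ j, (b j : ℤ) - (p - 1 : ℕ) := by
        have h2 : ∀ j, (((b - Pi.single t (p - 1) : Fin n → ℕ) j : ℕ) : ℤ)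
            = b j - ((Pi.single t (p - 1) : Fin n → ℕ) j : ℕ) := by
          intro j
          rcases eq_or_ne j t with rfl | hj
          · simp; omega
          · simp [hj]
        rw [Finset.sum_congr rfl fun j _ => h2 j, Finset.sum_sub_distrib, ← Nat.cast_sum _ (Pi.single _ _),
          Finset.sum_pi_single']
        simp
      have h3 := mon_mem (k := k) (b - Pi.single t (p - 1) : Fin n → ℕ)
      rw [h1] at h3
      convert h3 using 2
      omega
    · exact zero_mem _
  · rw [map_zero]; exact zero_mem _

/-! ### Extending operators from symmetric polynomials -/

omit hp [CharP k p] in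
/-- The operator `u s ↦ u T(s)` for `u ∈ U_n^+` and `s` symmetric. -/
def extend (T : Module.End k (Pol k n)) : Module.End k (Pol k n) :=
  ∑ b ∈ expos n, LinearMap.mulLeft k (mon k b) ∘ₗ T ∘ₗ coord k b

omit hp [CharP k p] in
theorem extend_apply (T : Module.End k (Pol k n)) (f : Pol k n) :
    extend T f = ∑ b ∈ expos n, mon k b * T (coord k b f) := by
  simp [extend]

theorem extend_mul (T : Module.End k (Pol k n)) {u e : Pol k n} (hu : u ∈ Uplus k n)
    (he : e.IsSymmetric) : extend T (u * e) = u * T e := by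
  rw [Uplus_eq_span] at hu
  induction hu using Submodule.span_induction with
  | mem u hu =>
    obtain ⟨c, hc, rfl⟩ := hu
    rw [extend_apply, Finset.sum_eq_single_of_mem c hc]
    · rw [coord_mul _ _ he, coord_mon hc hc, if_pos rfl, one_mul]
    · intro b hb hbc
      rw [coord_mul _ _ he, coord_mon hb hc, if_neg hbc, zero_mul, map_zero, mul_zero]
  | zero => simp
  | add u v _ _ hu hv => rw [add_mul, map_add, hu, hv, add_mul]
  | smul c u _ hu => rw [smul_mul_assoc, map_smul, hu, smul_mul_assoc]

/-- On a product `u s`, `repD` acts as `repD u * s + u * polD s`, preserving `U_n^+` and the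
symmetric polynomials. The terms with `repD u` cancel in the commutator. -/
theorem ad_extend (T : Module.End k (Pol k n)) :
    ad k (repD k n) (extend T) = extend (ad k (twistD 0) T) := by
  refine LinearMap.ext fun f => ?_
  have h : extend T (repD k n f) = ∑ b ∈ expos n,
      (repD k n (mon k b) * T (coord k b f) + mon k b * T (polD k n (coord k b f))) := by
    conv_lhs => rw [← sum_mon_mul_coord f]
    rw [map_sum, map_sum]
    refine Finset.sum_congr rfl fun b hb => ?_
    rw [repD_mul, map_add, extend_mul _ (repD_mem_Uplus (mon_mem_Uplus hb))
      (coord_isSymmetric _ _), extend_mul _ (mon_mem_Uplus hb)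
      (fun σ => by rw [← polD_rename, coord_isSymmetric b f σ])]
  rw [ad_apply, ad_apply, LinearMap.sub_apply, Module.End.mul_apply, Module.End.mul_apply,
    twistD_zero, h, extend_apply, extend_apply, map_sum, ← Finset.sum_sub_distrib]
  refine Finset.sum_congr rfl fun b hb => ?_
  rw [repD_mul]
  simp only [LinearMap.sub_apply, Module.End.mul_apply, Derivation.coeFn_coe]
  ring

theorem ad_pow_extend (T : Module.End k (Pol k n)) (m : ℕ) :
    (ad k (repD k n) ^ m) (extend T) = extend ((ad k (twistD 0) ^ m) T) := by
  induction m with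
  | zero => rfl
  | succ m ih =>
    rw [pow_succ', pow_succ', Module.End.mul_apply, Module.End.mul_apply, ih, ad_extend]

theorem hasDeg_extend {r : ℤ} {T : Module.End k (Pol k n)} (hT : HasDeg r T) :
    HasDeg r (extend T) := by
  refine HasDeg.sum _ fun b _ => ?_
  convert (hasDeg_mulLeft (mon_mem (k := k) b)).comp (hT.comp (hasDeg_coord b)) using 1
  ring

/-- Replacing each symmetric coordinate by its constant term turns the expansion of `f` into `proj k
n f`. -/
theorem ad_pow_extend_polHomotopy :
    (ad k (repD k n) ^ (p - 1)) (extend (polHomotopy p)) = proj k n - 1 := by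
  have h : (ad k (twistD (k := k) (n := n) 0) ^ (p - 1)) (polHomotopy p)
      = (Algebra.linearMap k (Pol k n)) ∘ₗ lcoeff k 0 - 1 := by
    refine pol_ext fun b => ?_
    rw [ad_pow_polHomotopy_mon, LinearMap.sub_apply, LinearMap.comp_apply, lcoeff_apply, coeff_mon]
    split_ifs with h0 h1 h1
    · subst h0; simp [mon]
    · exact (h1 (by simpa using h0)).elim
    · exact (h0 (by simpa using h1)).elim
    · simp
  rw [ad_pow_extend, h]
  refine LinearMap.ext fun f => ?_
  rw [extend_apply, LinearMap.sub_apply, proj_apply, Module.End.one_apply]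
  refine Eq.trans ?_ (congrArg (fun g => ∑ b ∈ expos n, coord₀ k b f • mon k b - g)
    (sum_mon_mul_coord f))
  rw [← Finset.sum_sub_distrib]
  refine Finset.sum_congr rfl fun b _ => ?_
  rw [LinearMap.sub_apply, Module.End.one_apply, mul_sub, LinearMap.comp_apply, coord₀,
    LinearMap.comp_apply, Algebra.linearMap_apply, mul_comm, ← Algebra.smul_def]

/-- Here `j_n ∘ π_n` is `postComp` of `proj`, and the identity is `postComp 1` by the resolution of
the identity, so the operator equation on `Pol_n` transfers. -/
theorem homotopic_incl_π :
    Homotopic p (grading k n) (grading k n) (d 1) (d 1)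
      ((incl k n).toLinearMap ∘ₗ (π k n).toLinearMap) LinearMap.id := by
  refine ⟨postComp (extend (polHomotopy p)),
    fun i y hy => postComp_mem (hasDeg_extend (hasDeg_polHomotopy p)) hy, ?_⟩
  have h1 := ad_pow_pred_prime (k := k) p (d (n := n) (1 : k)) (postComp (extend (polHomotopy p)))
  rw [ad_pow_postComp, ad_pow_extend_polHomotopy] at h1
  have h2 : postComp (proj k n - 1)
      = (incl k n).toLinearMap ∘ₗ (π k n).toLinearMap - LinearMap.id := by
    refine LinearMap.ext fun y => ?_
    have h3 : postComp (1 : Module.End k (Pol k n)) y = y := (eq_sum_polRep y).symm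
    have h4 : postComp (proj k n - 1) y = postComp (proj k n) y - postComp 1 y := by
      simp [postComp, ofValues, sub_mul]
    rw [h4, h3]
    rfl
  rw [← h2, h1]
  simp only [Module.End.mul_eq_comp, LinearMap.comp_assoc]

end

/-! ### The anti-involution, the case `a = -1`, and the `p`-DG structures. -/

section

variable {k : Type*} [Field k] {n : ℕ}

/-! ### The anti-involution -/

/-- Reversing products exchanges the two slide relations and preserves each of the others. -/
theorem revRelations : NilHeckeRelations (A := (NH k n)ᵐᵒᵖ)
    (fun i => MulOpposite.op (x k i)) (fun i hi => MulOpposite.op (δ k i hi)) where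
  sq i hi := by rw [← MulOpposite.op_mul, nilHeckeRelations.sq, MulOpposite.op_zero]
  braid i hi := by
    simp only [← MulOpposite.op_mul, ← mul_assoc]
    rw [nilHeckeRelations.braid]
  far i hi j hj h := by
    simp only [← MulOpposite.op_mul]
    rw [nilHeckeRelations.far i hi j hj h]
  dot_cross i j hj h h' := by
    simp only [← MulOpposite.op_mul]
    rw [nilHeckeRelations.dot_cross i j hj h h']
  dot_dot i j := by
    simp only [← MulOpposite.op_mul]
    rw [nilHeckeRelations.dot_dot i j]
  slide_left i hi := by
    simp only [← MulOpposite.op_mul, ← MulOpposite.op_sub]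
    rw [nilHeckeRelations.slide_right i hi, MulOpposite.op_one]
  slide_right i hi := by
    simp only [← MulOpposite.op_mul, ← MulOpposite.op_sub]
    rw [nilHeckeRelations.slide_left i hi, MulOpposite.op_one]

variable (k n) in
/-- The anti-involution of `NH_n` that fixes the generators, as a homomorphism to the opposite
algebra. -/
def revHom : NH k n →ₐ[k] (NH k n)ᵐᵒᵖ := lift _ _ revRelations

variable (k n) in
/-- The anti-involution of `NH_n` that fixes the generators. -/
def rev : NH k n →ₗ[k] NH k n :=
  (MulOpposite.opLinearEquiv k).symm.toLinearMap ∘ₗ (revHom k n).toLinearMap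

theorem rev_apply (y : NH k n) : rev k n y = (revHom k n y).unop := rfl

@[simp] theorem rev_x (i : Fin n) : rev k n (x k i) = x k i := by simp [rev_apply, revHom]

@[simp] theorem rev_δ (i : ℕ) (hi : i + 1 < n) : rev k n (δ k i hi) = δ k i hi := by
  simp [rev_apply, revHom]

@[simp] theorem rev_one : rev k n 1 = 1 := by simp [rev_apply]

theorem rev_mul (y z : NH k n) : rev k n (y * z) = rev k n z * rev k n y := by simp [rev_apply]

theorem rev_algebraMap (c : k) : rev k n (algebraMap k _ c) = algebraMap k _ c := by
  rw [Algebra.algebraMap_eq_smul_one, map_smul, rev_one]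

theorem rev_rev (y : NH k n) : rev k n (rev k n y) = y := by
  induction y using nh_induction with
  | algebraMap c => rw [rev_algebraMap, rev_algebraMap]
  | dot i => simp
  | cross i hi => simp
  | mul y z hy hz => rw [rev_mul, rev_mul, hy, hz]
  | add y z hy hz => rw [map_add, map_add, hy, hz]

/-- On a crossing, reversal gives `δ_i x_i` and `δ_i x_{i+1}`; the slide relations restore the
order, and their constant terms turn `a` into `-a`. -/
theorem rev_d (a : k) (y : NH k n) : rev k n (d a y) = d (-a) (rev k n y) := by
  induction y using nh_induction with
  | algebraMap c => rw [rev_algebraMap, d_algebraMap, d_algebraMap, map_zero]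
  | dot i => rw [d_x, rev_x, d_x, pow_two, rev_mul, rev_x]
  | cross i hi =>
    have h1 := sub_eq_iff_eq_add.1 ((nilHeckeRelations (k := k)).slide_left i hi)
    have h2 := sub_eq_iff_eq_add.1 ((nilHeckeRelations (k := k)).slide_right i hi)
    rw [d_δ, rev_δ, d_δ, map_add, map_sub, map_smul, map_smul, map_smul, rev_one, rev_mul, rev_mul,
      rev_x, rev_x, rev_δ, h1, h2]
    module
  | mul y z hy hz => rw [d_mul, map_add, rev_mul, rev_mul, hy, hz, rev_mul, d_mul, add_comm]
  | add y z hy hz => rw [map_add, map_add, map_add, map_add, hy, hz]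

theorem rev_polHom (f : Pol k n) : rev k n (polHom k n f) = polHom k n f := by
  induction f using MvPolynomial.induction_on with
  | C c => rw [← MvPolynomial.algebraMap_eq, AlgHom.commutes, rev_algebraMap]
  | add f g hf hg => rw [map_add, map_add, hf, hg]
  | mul_X f i hf => rw [map_mul, rev_mul, hf, polHom_X, rev_x, ← polHom_X, ← map_mul, mul_comm, map_mul]

theorem rev_mem {i : ℤ} {y : NH k n} (hy : y ∈ grading k n i) : rev k n y ∈ grading k n i := by
  have h : grading k n i ≤ (grading k n i).comap (rev k n) := by
    conv_lhs => rw [grading]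
    rw [Submodule.span_le]
    rintro _ ⟨l, hl, rfl⟩
    refine Submodule.subset_span ⟨l.reverse, by rw [List.map_reverse, List.sum_reverse, hl], ?_⟩
    clear hl
    induction l with
    | nil => exact rev_one
    | cons g l ih =>
      have hg : rev k n (gen g) = gen g := by
        cases g with
        | dot i => exact rev_x i
        | cross i hi => exact rev_δ i hi
      rw [List.map_cons, List.prod_cons, rev_mul, ih, hg]
      simp
  exact h hy

theorem rev_mem_symIdeal {y : NH k n} (hy : y ∈ symIdeal k n) : rev k n y ∈ symIdeal k n := by
  rw [mem_symIdeal] at hy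
  induction hy using Submodule.mul_induction_on' with
  | mem_mul_mem m hm z _ =>
    obtain ⟨e, he, rfl⟩ := hm
    rw [rev_mul, AlgHom.toLinearMap_apply, rev_polHom]
    refine Ideal.mul_mem_left _ _ ?_
    rw [mem_symIdeal, ← mul_one (polHom k n e)]
    exact Submodule.mul_mem_mul ⟨e, he, rfl⟩ trivial
  | add y _ z _ hy hz => rw [map_add]; exact add_mem hy hz

variable (k n) in
/-- The induced anti-involution of the quotient. -/
def revQuot : QuotNH k n →ₗ[k] QuotNH k n :=
  (MulOpposite.opLinearEquiv k).symm.toLinearMap ∘ₗ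
    (Ideal.Quotient.liftₐ (symIdeal k n) ((AlgHom.op (π k n)).comp (revHom k n)) fun y hy => by
      have := π_eq_zero.2 (rev_mem_symIdeal hy)
      rw [rev_apply] at this
      simp [this]).toLinearMap

@[simp] theorem revQuot_π (y : NH k n) : revQuot k n (π k n y) = π k n (rev k n y) := rfl

theorem revQuot_revQuot (m : QuotNH k n) : revQuot k n (revQuot k n m) = m := by
  obtain ⟨y, rfl⟩ := π_surjective m
  rw [revQuot_π, revQuot_π, rev_rev]

theorem revQuot_dQuot (a : k) (m : QuotNH k n) :
    revQuot k n (dQuot a m) = dQuot (-a) (revQuot k n m) := by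
  obtain ⟨y, rfl⟩ := π_surjective m
  rw [dQuot_π, revQuot_π, rev_d, revQuot_π, dQuot_π]

theorem revQuot_mem {i : ℤ} {m : QuotNH k n} (hm : m ∈ gradingQuot k n i) :
    revQuot k n m ∈ gradingQuot k n i := by
  obtain ⟨y, hy, rfl⟩ := hm
  exact ⟨rev k n y, rev_mem hy, rfl⟩

/-! ### Quasi-isomorphisms -/

theorem isMorphism_π (a : k) :
    IsMorphism (grading k n) (gradingQuot k n) (d a) (dQuot a) (π k n).toLinearMap :=
  ⟨fun _ _ hy => π_mem hy, rfl⟩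

theorem homotopic_refl {V W : Type*} [AddCommGroup V] [Module k V] [AddCommGroup W] [Module k W]
    (p : ℕ) (𝒱 : ℤ → Submodule k V) (𝒲 : ℤ → Submodule k W) (dV : Module.End k V)
    (dW : Module.End k W) (f : V →ₗ[k] W) : Homotopic p 𝒱 𝒲 dV dW f f :=
  ⟨0, fun _ _ _ => zero_mem _, by simp⟩

variable (p : ℕ) [hp : Fact p.Prime] [CharP k p]

theorem areQuasiInverse_π_incl :
    AreQuasiInverse p (grading k n) (gradingQuot k n) (d 1) (dQuot 1) (π k n).toLinearMap
      (incl k n).toLinearMap := by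
  refine ⟨isMorphism_π 1, ⟨fun _ _ hm => incl_mem hm, ?_⟩, homotopic_incl_π p, ?_⟩
  · exact LinearMap.ext fun m => (d_incl m).symm
  · have h : (π k n).toLinearMap ∘ₗ (incl k n).toLinearMap = LinearMap.id :=
      LinearMap.ext fun m => π_incl m
    rw [h]
    exact homotopic_refl _ _ _ _ _ _

/-- All the data for `∂_1` are conjugated by the anti-involutions. The resulting quasi-inverse is
built as a linear map, which is all that `IsQuasiIso` asks for. -/
theorem areQuasiInverse_π_rev :
    AreQuasiInverse p (grading k n) (gradingQuot k n) (d (-1)) (dQuot (-1)) (π k n).toLinearMap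
      (rev k n ∘ₗ (incl k n).toLinearMap ∘ₗ revQuot k n) := by
  refine ⟨isMorphism_π (-1), ⟨fun _ _ hm => rev_mem (incl_mem (revQuot_mem hm)), ?_⟩, ?_, ?_⟩
  · refine LinearMap.ext fun m => ?_
    change rev k n (incl k n (revQuot k n (dQuot (-1) m)))
      = d (-1) (rev k n (incl k n (revQuot k n m)))
    rw [revQuot_dQuot, neg_neg, ← d_incl, rev_d]
  · obtain ⟨h, hh, he⟩ := homotopic_incl_π (k := k) (n := n) p
    have hr : rev k n ∘ₗ rev k n = LinearMap.id := LinearMap.ext rev_rev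
    have hd : ∀ j, rev k n ∘ₗ (d 1 ^ j) = (d (-1) ^ j) ∘ₗ rev k n := by
      intro j
      induction j with
      | zero => rfl
      | succ j ih =>
        refine LinearMap.ext fun y => ?_
        have := LinearMap.congr_fun ih (d 1 y)
        simp only [LinearMap.comp_apply] at this
        rw [LinearMap.comp_apply, LinearMap.comp_apply, pow_succ, pow_succ, Module.End.mul_apply,
          Module.End.mul_apply, this, rev_d]
    refine ⟨rev k n ∘ₗ h ∘ₗ rev k n, fun i y hy => rev_mem (hh i _ (rev_mem hy)), ?_⟩
    have h1 : (rev k n ∘ₗ (incl k n).toLinearMap ∘ₗ revQuot k n) ∘ₗ (π k n).toLinearMap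
        - LinearMap.id = rev k n ∘ₗ ((incl k n).toLinearMap ∘ₗ (π k n).toLinearMap
          - LinearMap.id) ∘ₗ rev k n := by
      refine LinearMap.ext fun y => ?_
      simp [rev_rev]
    rw [h1, he]
    refine LinearMap.ext fun y => ?_
    simp only [LinearMap.comp_apply, LinearMap.sum_apply, map_sum]
    refine Finset.sum_congr rfl fun j _ => ?_
    have h2 := LinearMap.congr_fun (hd (p - 1 - j)) (h ((d 1 ^ j) (rev k n y)))
    have h3 := LinearMap.congr_fun (hd j) (rev k n y)
    simp only [LinearMap.comp_apply, rev_rev] at h2 h3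
    rw [h2, ← h3, rev_rev]
  · have h : (π k n).toLinearMap ∘ₗ (rev k n ∘ₗ (incl k n).toLinearMap ∘ₗ revQuot k n)
        = LinearMap.id := by
      refine LinearMap.ext fun m => ?_
      change π k n (rev k n (incl k n (revQuot k n m))) = m
      rw [← revQuot_π, π_incl, revQuot_revQuot]
    rw [h]
    exact homotopic_refl _ _ _ _ _ _

/-! ### `p`-DG algebras -/

theorem d_pow_prime {a : k} (ha : a = 1 ∨ a = -1) : d (n := n) a ^ p = 0 := by
  rcases ha with rfl | rfl
  · exact d_one_pow_prime p
  · have h : ∀ m (y : NH k n), (d (-1) ^ m) y = rev k n ((d 1 ^ m) (rev k n y)) := by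
      intro m
      induction m with
      | zero => intro y; simp [rev_rev]
      | succ m ih =>
        intro y
        rw [pow_succ', pow_succ', Module.End.mul_apply, Module.End.mul_apply, ih, rev_d]
    refine LinearMap.ext fun y => ?_
    rw [h, d_one_pow_prime]
    simp

theorem isPDGAlgebra_NH {a : k} (ha : a = 1 ∨ a = -1) : IsPDGAlgebra p (grading k n) (d a) where
  gradedMonoid := gradedMonoid_grading
  isInternal := isInternal_grading
  degree_two _ _ hy := d_mem_grading a hy
  nilpotent := d_pow_prime p ha
  leibniz := d_mul a

theorem dQuot_pow_π (a : k) (m : ℕ) (y : NH k n) :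
    (dQuot a ^ m) (π k n y) = π k n ((d a ^ m) y) := by
  induction m with
  | zero => rfl
  | succ m ih =>
    rw [pow_succ', pow_succ', Module.End.mul_apply, Module.End.mul_apply, ih, dQuot_π]

theorem isPDGAlgebra_quotNH {a : k} (ha : a = 1 ∨ a = -1) :
    IsPDGAlgebra p (gradingQuot k n) (dQuot a) where
  gradedMonoid := gradedMonoid_gradingQuot
  isInternal := isInternal_gradingQuot
  degree_two := by
    rintro i _ ⟨y, hy, rfl⟩
    exact ⟨d a y, d_mem_grading a hy, rfl⟩
  nilpotent := by
    refine LinearMap.ext fun m => ?_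
    obtain ⟨y, rfl⟩ := π_surjective m
    rw [dQuot_pow_π, d_pow_prime p ha]
    simp
  leibniz u v := by
    obtain ⟨y, rfl⟩ := π_surjective u
    obtain ⟨z, rfl⟩ := π_surjective v
    rw [← map_mul, dQuot_π, d_mul, map_add, map_mul, map_mul, dQuot_π, dQuot_π]

end

end PDG

end

theorem mainTheorem5 (p : ℕ) [Fact p.Prime] (k : Type*) [Field k] [CharP k p] (n : ℕ) :
    -- `π_n` is a surjective quasi-isomorphism of `p`-DG algebras for `a = ±1`
    (∀ a : k, a = 1 ∨ a = -1 →
      PDG.IsPDGAlgebra p (PDG.grading k n) (PDG.d a) ∧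
      PDG.IsPDGAlgebra p (PDG.gradingQuot k n) (PDG.dQuot a) ∧
      PDG.IsPDGHom (PDG.grading k n) (PDG.gradingQuot k n) (PDG.d a) (PDG.dQuot a) (PDG.π k n) ∧
      Function.Surjective (PDG.π k n) ∧
      PDG.IsQuasiIso p (PDG.grading k n) (PDG.gradingQuot k n) (PDG.d a) (PDG.dQuot a)
        (PDG.π k n).toLinearMap) ∧
    -- the quotient is the matrix algebra `END_k(Ū_n) ≅ M(n!, k)`
    (Function.Bijective (PDG.quotRep k n) ∧
      Module.finrank k (PDG.Ubar k n) = n.factorial ∧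
      Nonempty (PDG.QuotNH k n ≃ₐ[k] Matrix (Fin n.factorial) (Fin n.factorial) k)) ∧
    -- under `∂_1`, the inclusion `j_n` (which exists and is unique) is a quasi-inverse of `π_n`
    (∃ j : PDG.QuotNH k n →ₐ[k] PDG.NH k n,
      PDG.IsInclusion j ∧
      (∀ j' : PDG.QuotNH k n →ₐ[k] PDG.NH k n, PDG.IsInclusion j' → j' = j) ∧
      Function.Injective j ∧
      PDG.IsPDGHom (PDG.gradingQuot k n) (PDG.grading k n) (PDG.dQuot 1) (PDG.d 1) j ∧
      (PDG.π k n).comp j = AlgHom.id k (PDG.QuotNH k n) ∧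
      PDG.AreQuasiInverse p (PDG.grading k n) (PDG.gradingQuot k n) (PDG.d 1) (PDG.dQuot 1)
        (PDG.π k n).toLinearMap j.toLinearMap) := by
  refine ⟨fun a ha => ⟨PDG.isPDGAlgebra_NH p ha, PDG.isPDGAlgebra_quotNH p ha,
      ⟨fun _ _ hy => PDG.π_mem hy, fun _ => rfl⟩, PDG.π_surjective, ?_⟩,
    ⟨⟨PDG.quotRep_injective, PDG.quotRep_surjective⟩, PDG.finrank_Ubar,
      PDG.nonempty_quotNH_equiv_matrix⟩,
    PDG.incl k n, PDG.isInclusion_incl, fun _ hj => hj.eq_incl, PDG.incl_injective,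
    ⟨fun _ _ hm => PDG.incl_mem hm, fun m => (PDG.d_incl m).symm⟩,
    AlgHom.ext PDG.π_incl, PDG.areQuasiInverse_π_incl p⟩
  rcases ha with rfl | rfl
  · exact ⟨_, PDG.areQuasiInverse_π_incl p⟩
  · exact ⟨_, PDG.areQuasiInverse_π_rev p⟩
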